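/- Conventions. Let $\Sigma=\{0,1,\dots,k+1\}$ ($k\ge 0$) be a finite alphabet. A partial function on $\Sigma^\omega$ (or $\Sigma^\omega\times\Sigma^\omega\to\Sigma^\omega$) is computable if a Type-2 Turing machine computes it. For $w=a_1\dots a_n\in\Sigma^*$ put $\iota(w)=110a_10a_2\dots 0a_n011$ and $\langle w_1,\dots,w_m\rangle=\iota(w_1)\dots\iota(w_m)$; a sequence $p\in\Sigma^\omega$ is a list of a set $W\subseteq\Sigma^*$ if for all $w\in\Sigma^*$: $\iota(w)$ is a subword of $p$ iff $w\in W$. Let $\nu_{\mathbb Q}:\subseteq\Sigma^*\to\mathbb Q$ be a standard notation of the rational numbers (built from binary notation of integers), and let $\rho$ be the standard representation of the real numbers, in which a name of $x$ is an interleaved pair of a list of all rationals $<x$ and a list of all rationals $>x$. A representation of a set $X$ is a partial surjective map $\delta:\subseteq\Sigma^\omega\to X$. For representations $\delta$ of $X$ and $\delta'$ of $Y$, a partial function $F:\subseteq\Sigma^\omega\to\Sigma^\omega$ realizes $f:(X,\delta)\to(Y,\delta')$ if $\delta'(F(p))=f(\delta(p))$ for all $p\in\mathrm{dom}(\delta)$.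 For functions $f,g$ between represented sets, $f\le_W g$ (resp. $f\le_{sW} g$) means that there are computable partial functions $G,H$ such that for every realizer $F$ of $g$, $p\mapsto H(p,F(G(p)))$ (resp. $p\mapsto H(F(G(p)))$) realizes $f$; $f\equiv_{sW}g$ means $f\le_{sW}g$ and $g\le_{sW}f$. Let $\mathrm{En}(p)=\{n\in\mathbb N: 01^{n+1}0\text{ is a subword of }p\}$ and let $\mathrm{CE}:(2^{\mathbb N},\mathrm{En})\to(2^{\mathbb N},\mathrm{En})$ be $K\mapsto\mathbb N\setminus K$. A computable $\sigma$-algebra is a tuple $(\Omega,\mathcal A,\mathcal R,\alpha)$, where $\mathcal R$ is a countable ring of subsets of $\Omega$ with $\bigcup\mathcal R=\Omega$, $\mathcal A$ is the $\sigma$-algebra generated by $\mathcal R$, and $\alpha:\subseteq\Sigma^*\to\mathcal R$ is a partial surjective map with recursive domain with respect to which $(A,B)\mapsto A\cup B$ and $(A,B)\mapsto A\setminus B$ are computable on $\mathcal R$. A measure $\mu$ on $\mathcal A$ is computable if $\mu(R)<\infty$ for all $R\in\mathcal R$ and $R\mapsto\mu(R)$ is $(\alpha,\rho)$-computable on $\mathcal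 R$, that is, some machine maps every $v\in\mathrm{dom}(\alpha)$ to a $\rho$-name of $\mu(\alpha(v))$. Let $[\mathcal A]$ be the set of classes $[A]$ of $\mathcal A$ modulo $A\sim B\iff\mu(A\,\Delta\,B)=0$. Define representations of $[\mathcal A]$ as follows: - $\zeta_+(p)=[A]$ iff $p$ is a list of all $\langle u,v\rangle$ with $\nu_{\mathbb Q}(u)<\mu(\alpha(v)\cap A)$; - $\zeta_-(p)=[A]$ iff $p$ is a list of all $\langle v,w\rangle$ with $\mu(\alpha(v)\cap A)<\nu_{\mathbb Q}(w)$; - $\zeta(p)=[A]$ iff $p$ is a list of all $\langle u,v,w\rangle$ with $\nu_{\mathbb Q}(u)<\mu(\alpha(v)\cap A)<\nu_{\mathbb Q}(w)$. Let $\mathcal A_+,\mathcal A_-,\mathcal A_0$ be $[\mathcal A]$ represented by $\zeta_+,\zeta_-,\zeta$, respectively, and for $a,b\in\{+,-,0\}$ let $\mathrm{id}_{ab}:\mathcal A_a\to\mathcal A_b$ be the identity $[A]\mapsto[A]$. Theorem. 1. For every computable measure on a computable $\sigma$-algebra, $$\mathrm{id}_{+-}\le_{sW}\mathrm{id}_{+0}\le_{sW}\mathrm{CE},\qquad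 \mathrm{id}_{+0}\le_W\mathrm{id}_{+-},$$ $$\mathrm{id}_{-+}\le_{sW}\mathrm{id}_{-0}\le_{sW}\mathrm{CE},\qquad \mathrm{id}_{-0}\le_W\mathrm{id}_{-+}.$$ 2. There is a computable probability measure on a computable $\sigma$-algebra such that each of $\mathrm{id}_{+-}$, $\mathrm{id}_{+0}$, $\mathrm{id}_{-+}$, $\mathrm{id}_{-0}$ is $\equiv_{sW}\mathrm{CE}$. In fact one can take $\Omega=\mathbb N$, $\mathcal A=2^{\mathbb N}$, $\mathcal R$ the ring of finite subsets of $\mathbb N$ (with a suitable notation $\alpha$), and $\mu(A)=\frac23\sum_{i\in A}3^{-i}$. -/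

import Mathlib

open MeasureTheory

/-! ## Words, infinite sequences and Type-2 computability -/

/-- The finite alphabet `Σ = {0, 1, …, k + 1}`; it contains the symbols `0` and `1`. -/
abbrev Symb (k : ℕ) : Type := Fin (k + 2)

/-- Finite words `Σ^*`. -/
abbrev Word (k : ℕ) : Type := List (Symb k)

/-- Infinite sequences `Σ^ω`. -/
abbrev OmegaSeq (k : ℕ) : Type := ℕ → Symb k

section TypeTwo

variable {k : ℕ}

/-- The prefix of length `n` of an infinite sequence. -/
def OmegaSeq.pre (p : OmegaSeq k) (n : ℕ) : Word k := (List.range n).map p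

/-- A partial function `G :⊆ Σ^ω → Σ^ω` is computable (by a Type-2 machine): there is a computable
word function `φ`, monotone for the prefix order (`φ w` is what the machine has written on its
one-way output tape after reading `w`), such that `G p = q` iff the outputs `φ (p|m)` grow to `q`.
In particular `G p` is undefined iff only finitely many symbols are written on input `p`. -/
def ComputableSeqFun (G : OmegaSeq k →. OmegaSeq k) : Prop :=
  ∃ φ : Word k → Word k, Computable φ ∧
    (∀ v w, v <+: w → φ v <+: φ w) ∧
    ∀ p q, q ∈ G p ↔ ∀ n, ∃ m, q.pre n <+: φ (p.pre m)

/-- Computability of a partial function `H :⊆ Σ^ω × Σ^ω → Σ^ω`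
(a Type-2 machine with two input tapes). -/
def ComputableSeqFun₂ (H : OmegaSeq k → OmegaSeq k →. OmegaSeq k) : Prop :=
  ∃ φ : Word k → Word k → Word k, Computable₂ φ ∧
    (∀ v w v' w', v <+: w → v' <+: w' → φ v v' <+: φ w w') ∧
    ∀ p p' q, q ∈ H p p' ↔ ∀ n, ∃ m, q.pre n <+: φ (p.pre m) (p'.pre m)

/-- The word `w` is a (contiguous) subword of the sequence `p`. -/
def Subword (w : Word k) (p : OmegaSeq k) : Prop :=
  ∃ i, ∀ (j : ℕ) (hj : j < w.length), p (i + j) = w[j]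

/-- The wrapping function `ι(a₁a₂…aₙ) = 110a₁0a₂…0aₙ011`. -/
def wrap (w : Word k) : Word k := [1, 1] ++ w.flatMap (fun a => [0, a]) ++ [0, 1, 1]

/-- `⟨w₁, …, wₙ⟩ = ι(w₁)…ι(wₙ)`. -/
def tuple (l : List (Word k)) : Word k := l.flatMap wrap

/-- The set of words listed by `p`: all `w` such that `ι(w)` is a subword of `p`. -/
def listed (p : OmegaSeq k) : Set (Word k) := {w | Subword (wrap w) p}

/-! ## Notations of the natural and the rational numbers -/

/-- The binary notation of `ℕ`, with domain `{0} ∪ 1{0,1}^*`. -/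
def nuNat (w : Word k) : Option ℕ :=
  if w = [0] ∨ (w.head? = some 1 ∧ ∀ a ∈ w, a = 0 ∨ a = 1) then
    some (w.foldl (fun n a => 2 * n + a.val) 0)
  else none

/-- The notation of `ℚ` (given by its graph): `⟨x, y, z⟩` denotes `(m - n) / d` if `x, y, z` are
the binary notations of `m, n, d` and `d ≠ 0`. -/
def NuRat (w : Word k) (a : ℚ) : Prop :=
  ∃ x y z m n d, w = tuple [x, y, z] ∧ nuNat x = some m ∧ nuNat y = some n ∧
    nuNat z = some d ∧ d ≠ 0 ∧ a = ((m : ℚ) - n) / d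

/-! ## Representations and Weihrauch reducibility -/

/-- A representation of `X`: a partial surjective function `Σ^ω → X`, given by its graph
(`names p x` means that `p` is a name of `x`). -/
structure NameRep (k : ℕ) (X : Type*) where
  names : OmegaSeq k → X → Prop
  unique : ∀ {p x y}, names p x → names p y → x = y
  surj : ∀ x, ∃ p, names p x

/-- A function between two represented sets. -/
structure RepFun (k : ℕ) (X Y : Type*) where
  source : NameRep k X
  target : NameRep k Y
  toFun : X → Y

section Weihrauch

variable {X Y X' Y' : Type*}

/-- The partial function `F` on names realizes `f`. -/
def RepFun.Realizes (f : RepFun k X Y) (F : OmegaSeq k →. OmegaSeq k) : Prop :=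
  ∀ p x, f.source.names p x → ∃ q ∈ F p, f.target.names q (f.toFun x)

/-- Weihrauch reducibility `f ≤_W g`: `p ↦ H(p, F (G p))` realizes `f` for every realizer `F`
of `g`. -/
def RepFun.LeW (f : RepFun k X Y) (g : RepFun k X' Y') : Prop :=
  ∃ (G : OmegaSeq k →. OmegaSeq k) (H : OmegaSeq k → OmegaSeq k →. OmegaSeq k),
    ComputableSeqFun G ∧ ComputableSeqFun₂ H ∧
      ∀ F, g.Realizes F → f.Realizes fun p => ((G p).bind F).bind (H p)

/-- Strong Weihrauch reducibility `f ≤_sW g`: `p ↦ H (F (G p))` realizes `f` for every realizer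
`F` of `g`. -/
def RepFun.LeSW (f : RepFun k X Y) (g : RepFun k X' Y') : Prop :=
  ∃ (G H : OmegaSeq k →. OmegaSeq k), ComputableSeqFun G ∧ ComputableSeqFun H ∧
    ∀ F, g.Realizes F → f.Realizes fun p => ((G p).bind F).bind H

/-- Strong Weihrauch equivalence. -/
def RepFun.EquivSW (f : RepFun k X Y) (g : RepFun k X' Y') : Prop := f.LeSW g ∧ g.LeSW f

end Weihrauch

/-! ## Computable σ-algebras and computable measures -/

/-- The Mathlib σ-algebra of `Ω` together with a ring and a notation `α` of this ring that make it a
computable σ-algebra. `alpha w = none` means that `w` is not in the domain of `α`;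
the ring is the range of `α`. -/
structure CompSigmaAlgebra (k : ℕ) (Ω : Type*) [mΩ : MeasurableSpace Ω] where
  alpha : Word k → Option (Set Ω)
  isSetRing : IsSetRing {R | ∃ v, alpha v = some R}
  sUnion_ring : ⋃₀ {R | ∃ v, alpha v = some R} = Set.univ
  generates : mΩ = MeasurableSpace.generateFrom {R | ∃ v, alpha v = some R}
  dom_recursive : ComputablePred fun v => ∃ R, alpha v = some R
  union_computable : ∃ h : Word k → Word k →. Word k, Partrec₂ h ∧
    ∀ u v A B, alpha u = some A → alpha v = some B → ∃ w ∈ h u v, alpha w = some (A ∪ B)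
  diff_computable : ∃ h : Word k → Word k →. Word k, Partrec₂ h ∧
    ∀ u v A B, alpha u = some A → alpha v = some B → ∃ w ∈ h u v, alpha w = some (A \ B)

/-- `ρ_<(p) = x`: `p` lists all (names of) rational numbers `a < x`. -/
def RhoLower (p : OmegaSeq k) (x : ℝ) : Prop := listed p = {u | ∃ a, NuRat u a ∧ (a : ℝ) < x}

/-- `ρ_>(p) = x`: `p` lists all (names of) rational numbers `a > x`. -/
def RhoUpper (p : OmegaSeq k) (x : ℝ) : Prop := listed p = {u | ∃ a, NuRat u a ∧ x < (a : ℝ)}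

/-- `ρ⟨p, q⟩ = x` iff `ρ_<(p) = x` and `ρ_>(q) = x`, where `⟨p, q⟩ = p(0)q(0)p(1)q(1)…`. -/
def Rho (r : OmegaSeq k) (x : ℝ) : Prop :=
  RhoLower (fun n => r (2 * n)) x ∧ RhoUpper (fun n => r (2 * n + 1)) x

section Measures

variable {Ω : Type*} [MeasurableSpace Ω]

/-- The ring of a computable σ-algebra. -/
def CompSigmaAlgebra.ring (C : CompSigmaAlgebra k Ω) : Set (Set Ω) := {R | ∃ v, C.alpha v = some R}

/-- `μ` is finite on the ring and `R ↦ μ(R)` is `(α, ρ)`-computable on the ring: some machine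
computes, on input `v ∈ dom(α)`, the symbols of a `ρ`-name of `μ(α(v))`. -/
def IsComputableMeasure (C : CompSigmaAlgebra k Ω) (μ : Measure Ω) : Prop :=
  (∀ R ∈ C.ring, μ R < ⊤) ∧
    ∃ h : Word k → ℕ →. Symb k, Partrec₂ h ∧
      ∀ v R, C.alpha v = some R → ∃ r : OmegaSeq k, (∀ n, r n ∈ h v n) ∧ Rho r (μ.real R)

/-- `A ∼ B` iff `μ(A Δ B) = 0`, on the measurable sets. -/
def nullSetoid (μ : Measure Ω) : Setoid {A : Set Ω // MeasurableSet A} where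
  r A B := μ (symmDiff A.1 B.1) = 0
  iseqv :=
    { refl := fun A => by simp
      symm := fun {A B} h => by rwa [symmDiff_comm]
      trans := fun {A B D} h h' => by
        rw [measure_symmDiff_eq_zero_iff] at *
        exact h.trans h' }

/-- The set `[𝒜]` of equivalence classes of measurable sets. -/
def MeasClass (μ : Measure Ω) : Type _ := Quotient (nullSetoid μ)

/-- The class `[A]`. -/
def MeasClass.mk (μ : Measure Ω) (A : {A : Set Ω // MeasurableSet A}) : MeasClass μ :=
  Quotient.mk (nullSetoid μ) A

/-- All `⟨u, v⟩` with `ν_ℚ(u) < μ(α(v) ∩ A)`. -/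
def plusWords (C : CompSigmaAlgebra k Ω) (μ : Measure Ω) (A : Set Ω) : Set (Word k) :=
  {x | ∃ u v a R, x = tuple [u, v] ∧ NuRat u a ∧ C.alpha v = some R ∧ (a : ℝ) < μ.real (R ∩ A)}

/-- All `⟨v, w⟩` with `μ(α(v) ∩ A) < ν_ℚ(w)`. -/
def minusWords (C : CompSigmaAlgebra k Ω) (μ : Measure Ω) (A : Set Ω) : Set (Word k) :=
  {x | ∃ v w b R, x = tuple [v, w] ∧ C.alpha v = some R ∧ NuRat w b ∧ μ.real (R ∩ A) < (b : ℝ)}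

/-- All `⟨u, v, w⟩` with `ν_ℚ(u) < μ(α(v) ∩ A) < ν_ℚ(w)`. -/
def zeroWords (C : CompSigmaAlgebra k Ω) (μ : Measure Ω) (A : Set Ω) : Set (Word k) :=
  {x | ∃ u v w a b R, x = tuple [u, v, w] ∧ NuRat u a ∧ C.alpha v = some R ∧ NuRat w b ∧
    (a : ℝ) < μ.real (R ∩ A) ∧ μ.real (R ∩ A) < (b : ℝ)}

end Measures

/-! ## Facts showing that the representations are well defined and surjective -/

theorem wrap_append_inj : ∀ {x y r s : Word k}, wrap x ++ r = wrap y ++ s → x = y ∧ r = s := by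
  have key : ∀ (x y r s : Word k),
      x.flatMap (fun a => [0, a]) ++ ([0, 1, 1] ++ r) =
        y.flatMap (fun a => [0, a]) ++ ([0, 1, 1] ++ s) → x = y ∧ r = s := by
    intro x
    induction x with
    | nil =>
      intro y r s h
      cases y with
      | nil => simpa using h
      | cons b y =>
        cases y <;> simp at h
    | cons a x ih =>
      intro y r s h
      cases y with
      | nil => cases x <;> simp at h
      | cons b y =>
        simp only [List.flatMap_cons, List.cons_append, List.nil_append,
          List.cons.injEq, true_and] at h
        obtain ⟨h1, h2⟩ := ih y r s (by simpa using h.2)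
        exact ⟨by rw [h.1, h1], h2⟩
  intro x y r s h
  refine key x y r s ?_
  simpa [wrap] using h

theorem tuple_inj : ∀ {l l' : List (Word k)}, tuple l = tuple l' → l = l' := by
  intro l
  induction l with
  | nil => intro l' h; cases l' <;> simp_all [tuple, wrap]
  | cons x l ih =>
    intro l' h
    cases l' with
    | nil => simp [tuple, wrap] at h
    | cons y l' =>
      obtain ⟨h1, h2⟩ := wrap_append_inj (by simpa [tuple] using h)
      rw [h1, ih h2]

theorem NuRat.unique {w : Word k} {a b : ℚ} (ha : NuRat w a) (hb : NuRat w b) : a = b := by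
  obtain ⟨x, y, z, m, n, d, h, hx, hy, hz, -, rfl⟩ := ha
  obtain ⟨x', y', z', m', n', d', h', hx', hy', hz', -, rfl⟩ := hb
  have := tuple_inj (h.symm.trans h')
  simp only [List.cons.injEq, and_true] at this
  obtain ⟨rfl, rfl, rfl⟩ := this
  simp_all

theorem nuNat_surj (n : ℕ) : ∃ w : Word k, nuNat w = some n := by
  have key : ∀ n, 1 ≤ n → ∃ w : Word k, (w.head? = some 1 ∧ ∀ a ∈ w, a = 0 ∨ a = 1) ∧
      w.foldl (fun n a => 2 * n + a.val) 0 = n := by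
    intro n
    induction n using Nat.strong_induction_on with
    | _ n ih =>
      intro hn
      rcases Nat.lt_or_ge n 2 with h | h
      · obtain rfl : n = 1 := by omega
        exact ⟨[1], by simp⟩
      · obtain ⟨w, ⟨h1, h2⟩, h3⟩ := ih (n / 2) (by omega) (by omega)
        have hw : (w ++ [1]).head? = some 1 ∧ (w ++ [0]).head? = some 1 := by
          cases w <;> simp_all
        rcases Nat.mod_two_eq_zero_or_one n with e | e
        · refine ⟨w ++ [0], ⟨hw.2, ?_⟩, ?_⟩
          · intro a ha
            rcases List.mem_append.1 ha with ha | ha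
            · exact h2 a ha
            · simp_all
          · rw [List.foldl_append, h3]; simp; omega
        · refine ⟨w ++ [1], ⟨hw.1, ?_⟩, ?_⟩
          · intro a ha
            rcases List.mem_append.1 ha with ha | ha
            · exact h2 a ha
            · simp_all
          · rw [List.foldl_append, h3]; simp; omega
  rcases Nat.eq_zero_or_pos n with rfl | hn
  · exact ⟨[0], by simp [nuNat]⟩
  · obtain ⟨w, h1, h2⟩ := key n hn
    exact ⟨w, by rw [nuNat, if_pos (Or.inr h1), h2]⟩

theorem NuRat.surj (a : ℚ) : ∃ w : Word k, NuRat w a := by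
  obtain ⟨x, hx⟩ := nuNat_surj (k := k) a.num.toNat
  obtain ⟨y, hy⟩ := nuNat_surj (k := k) (-a.num).toNat
  obtain ⟨z, hz⟩ := nuNat_surj (k := k) a.den
  refine ⟨tuple [x, y, z], x, y, z, _, _, _, rfl, hx, hy, hz, a.den_ne_zero, ?_⟩
  have : ((a.num.toNat : ℚ) - ((-a.num).toNat : ℚ)) = (a.num : ℚ) := by
    have h : ((a.num.toNat : ℤ) - ((-a.num).toNat : ℤ)) = a.num := by omega
    exact_mod_cast h
  rw [this, Rat.num_div_den]

/-- The sequence that carries the word `g m`, followed by symbols `c`, on the positions from `2 ^ m`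
to `2 ^ (m + 1) - 1` (only symbols `c` if the word is too long). -/
def blocks (g : ℕ → Word k) (c : Symb k) : OmegaSeq k := fun t =>
  if t ≠ 0 ∧ (g (Nat.log 2 t)).length ≤ 2 ^ Nat.log 2 t then
    (g (Nat.log 2 t)).getD (t - 2 ^ Nat.log 2 t) c
  else c

theorem blocks_apply (g : ℕ → Word k) (c : Symb k) (m o : ℕ) (ho : o < 2 ^ m) :
    blocks g c (2 ^ m + o) = if (g m).length ≤ 2 ^ m then (g m).getD o c else c := by
  have hl : Nat.log 2 (2 ^ m + o) = m := by
    rw [Nat.log_eq_iff (by omega)]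
    constructor
    · omega
    · rw [pow_succ]; omega
  have hp : 0 < 2 ^ m := by positivity
  unfold blocks
  rw [hl]
  have : 2 ^ m + o ≠ 0 := by omega
  simp

theorem exists_block (g : ℕ → Word k) (c : Symb k) {t : ℕ} (h : blocks g c t ≠ c) :
    ∃ m o, t = 2 ^ m + o ∧ o < (g m).length ∧ (g m).length ≤ 2 ^ m := by
  unfold blocks at h
  split_ifs at h with h1
  · refine ⟨Nat.log 2 t, t - 2 ^ Nat.log 2 t, ?_, ?_, h1.2⟩
    · have := Nat.pow_log_le_self 2 h1.1
      omega
    · by_contra hc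
      exact h (by rw [List.getD_eq_getElem?_getD, List.getElem?_eq_none (by omega)]; rfl)
  · exact absurd rfl h

theorem blocks_inside (g : ℕ → Word k) (c : Symb k) {m : ℕ} (h : (g m).length ≤ 2 ^ m) (o : ℕ)
    (ho : o < (g m).length) : blocks g c (2 ^ m + o) = (g m)[o] := by
  rw [blocks_apply g c m o (by omega), if_pos h, List.getD_eq_getElem _ _ ho]

theorem subword_blocks (g : ℕ → Word k) (c : Symb k) (w : Word k) (n : ℕ)
    (h : ∀ m, m.unpair.1 = n → g m = w) : Subword w (blocks g c) := by
  have hm : g (Nat.pair n w.length) = w := h _ (by simp)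
  have hl : w.length ≤ 2 ^ (Nat.pair n w.length) :=
    (Nat.right_le_pair n w.length).trans (Nat.lt_two_pow_self).le
  refine ⟨2 ^ (Nat.pair n w.length), fun j hj => ?_⟩
  rw [blocks_inside g c (by rw [hm]; exact hl) j (by rw [hm]; exact hj)]
  simp [hm]

theorem wrap_length (w : Word k) : (wrap w).length = 2 * w.length + 5 := by
  simp [wrap, List.length_flatMap]; omega

theorem wrap_getElem? (w : Word k) :
    (wrap w)[0]? = some 1 ∧ (wrap w)[1]? = some 1 ∧
    (∀ j, j ≤ w.length → (wrap w)[2 * j + 2]? = some 0) ∧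
    (∀ j, j < w.length → (wrap w)[2 * j + 3]? = w[j]?) ∧
    (wrap w)[2 * w.length + 3]? = some 1 ∧ (wrap w)[2 * w.length + 4]? = some 1 := by
  have e : ∀ i, (wrap w)[i + 2]? = (w.flatMap (fun a => [0, a]) ++ [0, 1, 1])[i]? := by
    intro i; simp [wrap]
  have key : ∀ w : Word k,
      (∀ j, j ≤ w.length → (w.flatMap (fun a => [0, a]) ++ [0, 1, 1])[2 * j]? = some 0) ∧
      (∀ j, j < w.length → (w.flatMap (fun a => [0, a]) ++ [0, 1, 1])[2 * j + 1]? = w[j]?) ∧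
      (w.flatMap (fun a => [0, a]) ++ [0, 1, 1])[2 * w.length + 1]? = some 1 ∧
      (w.flatMap (fun a => [0, a]) ++ [0, 1, 1])[2 * w.length + 2]? = some 1 := by
    intro w
    induction w with
    | nil => simp
    | cons a w ih =>
      obtain ⟨h1, h2, h3, h4⟩ := ih
      refine ⟨?_, ?_, ?_, ?_⟩
      · intro j hj
        cases j with
        | zero => simp
        | succ j => simpa [Nat.mul_add] using h1 j (by simpa using hj)
      · intro j hj
        cases j with
        | zero => simp
        | succ j => simpa [Nat.mul_add] using h2 j (by simpa using hj)
      · simpa [Nat.mul_add] using h3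
      · simpa [Nat.mul_add] using h4
  obtain ⟨h1, h2, h3, h4⟩ := key w
  refine ⟨by simp [wrap], by simp [wrap], fun j hj => ?_, fun j hj => ?_, ?_, ?_⟩
  · rw [e, h1 j hj]
  · rw [show 2 * j + 3 = (2 * j + 1) + 2 by ring, e, h2 j hj]
  · rw [show 2 * w.length + 3 = (2 * w.length + 1) + 2 by ring, e, h3]
  · rw [show 2 * w.length + 4 = (2 * w.length + 2) + 2 by ring, e, h4]

/-- Every set of words is listed by some sequence. -/
theorem listed_surj (W : Set (Word k)) : ∃ p : OmegaSeq k, listed p = W := by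
  classical
  let g : ℕ → Word k := fun m =>
    match (Encodable.decode m.unpair.1 : Option (Word k)) with
    | some w => if w ∈ W then wrap w else []
    | none => []
  have hg : ∀ m, (g m).length ≠ 0 → ∃ w ∈ W, g m = wrap w := by
    intro m hm
    simp only [g] at hm ⊢
    split at hm
    · split_ifs at hm with hW
      · rename_i w hw
        exact ⟨w, hW, by simp [hW]⟩
      · exact absurd rfl hm
    · exact absurd rfl hm
  refine ⟨blocks g 1, Set.ext fun x => ⟨?_, fun hx => ?_⟩⟩
  · rintro ⟨i, hi⟩
    have hi' : ∀ j a, (wrap x)[j]? = some a → blocks g 1 (i + j) = a := by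
      intro j a h
      obtain ⟨hj, rfl⟩ := List.getElem?_eq_some_iff.1 h
      exact hi j hj
    obtain ⟨x0, x1, xe, xo, xl, xl'⟩ := wrap_getElem? x
    have h2 : blocks g 1 (i + 2) = 0 := hi' 2 0 (xe 0 (Nat.zero_le _))
    obtain ⟨m, o, hio, ho, hm⟩ := exists_block g 1 (t := i + 2) (by rw [h2]; simp)
    obtain ⟨w, hwW, hgw⟩ := hg m (by omega)
    obtain ⟨w0, w1, we, wo, wl, wl'⟩ := wrap_getElem? w
    have hb : ∀ j a, (wrap w)[j]? = some a → blocks g 1 (2 ^ m + j) = a := by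
      intro j a h
      obtain ⟨hj, rfl⟩ := List.getElem?_eq_some_iff.1 h
      rw [blocks_inside g 1 hm j (by rw [hgw]; exact hj)]
      simp [hgw]
    have hlen : (g m).length = 2 * w.length + 5 := by rw [hgw, wrap_length]
    have h01 : (0 : Symb k) ≠ 1 := by simp
    have hzero : ∀ j, 2 ≤ j → j % 2 = 0 → j ≤ 2 * w.length + 2 → blocks g 1 (2 ^ m + j) = 0 := by
      intro j h1 h2 h3
      have := hb (2 * (j / 2 - 1) + 2) 0 (we (j / 2 - 1) (by omega))
      rwa [show 2 * (j / 2 - 1) + 2 = j by omega] at this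
    have ho2 : o = 2 := by
      by_contra hne
      have hA : blocks g 1 (2 ^ m + o) = 0 := by rw [← hio]; exact h2
      have hB := hi' 0 1 x0
      have hC := hi' 1 1 x1
      have hoE : o ≤ 2 * w.length + 2 := by
        by_contra hlt
        have : o = 2 * w.length + 3 ∨ o = 2 * w.length + 4 := by omega
        rcases this with h | h
        · rw [h, hb _ _ wl] at hA; exact h01 hA.symm
        · rw [h, hb _ _ wl'] at hA; exact h01 hA.symm
      rcases Nat.lt_or_ge o 2 with h | h
      · have : o = 0 ∨ o = 1 := by omega
        rcases this with h | h
        · rw [h, hb _ _ w0] at hA; exact h01 hA.symm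
        · rw [h, hb _ _ w1] at hA; exact h01 hA.symm
      · rcases Nat.mod_two_eq_zero_or_one o with e | e
        · have := hzero (o - 2) (by omega) (by omega) (by omega)
          rw [show 2 ^ m + (o - 2) = i + 0 by omega, hB] at this
          exact h01 this.symm
        · have := hzero (o - 1) (by omega) (by omega) (by omega)
          rw [show 2 ^ m + (o - 1) = i + 1 by omega, hC] at this
          exact h01 this.symm
    have him : i = 2 ^ m := by omega
    rw [him] at hi'
    have hxw : x.length = w.length := by
      rcases lt_trichotomy x.length w.length with h | h | h
      · have h1 := hi' _ _ xl'
        have h3 := hzero (2 * x.length + 4) (by omega) (by omega) (by omega)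
        rw [h1] at h3; exact absurd h3.symm h01
      · exact h
      · have h1 := hb _ _ wl'
        have h3 := hi' _ _ (xe (w.length + 1) (by omega))
        rw [show 2 * (w.length + 1) + 2 = 2 * w.length + 4 by ring, h1] at h3
        exact absurd h3.symm h01
    have : x = w := by
      refine List.ext_getElem hxw fun j h1 h2 => ?_
      have e1 := hi' (2 * j + 3) x[j] (by rw [xo j h1, List.getElem?_eq_getElem h1])
      have e2 := hb (2 * j + 3) w[j] (by rw [wo j h2, List.getElem?_eq_getElem h2])
      rw [← e1, ← e2]
    rw [this]; exact hwW
  · refine subword_blocks g 1 (wrap x) (Encodable.encode x) fun m hm => ?_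
    simp [g, hm, hx]

/-- `01^{n+1}0`. -/
def unaryWord (n : ℕ) : Word k := [0] ++ List.replicate (n + 1) 1 ++ [0]

theorem unaryWord_length (n : ℕ) : (unaryWord n : Word k).length = n + 3 := by
  simp [unaryWord]

theorem unaryWord_getElem (n j : ℕ) (hj : j < (unaryWord n : Word k).length) :
    (unaryWord n : Word k)[j] = if 1 ≤ j ∧ j ≤ n + 1 then 1 else 0 := by
  rw [unaryWord_length] at hj
  simp only [unaryWord]
  rcases Nat.eq_zero_or_pos j with rfl | h
  · simp
  · rcases Nat.lt_or_ge j (n + 2) with h' | h'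
    · rw [List.getElem_append_left (by simp; omega), List.getElem_append_right (by simp; omega),
        List.getElem_replicate, if_pos (by omega)]
    · rw [List.getElem_append_right (by simp; omega), if_neg (by omega)]
      simp

/-- The enumeration representation `En` of the subsets of `ℕ`. -/
def enumerated (p : OmegaSeq k) : Set ℕ := {n | Subword (unaryWord n) p}

theorem enumerated_surj (K : Set ℕ) : ∃ p : OmegaSeq k, enumerated p = K := by
  classical
  let g : ℕ → Word k := fun m => if m.unpair.1 ∈ K then unaryWord m.unpair.1 else []
  refine ⟨blocks g 0, Set.ext fun n => ⟨?_, fun hn => ?_⟩⟩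
  · rintro ⟨i, hi⟩
    have h01 : (0 : Symb k) ≠ 1 := by simp
    have hi' : ∀ j, j < n + 3 → blocks g 0 (i + j) = if 1 ≤ j ∧ j ≤ n + 1 then 1 else 0 := by
      intro j hj
      rw [hi j (by rw [unaryWord_length]; exact hj), unaryWord_getElem]
    have h1 : blocks g 0 (i + 1) = 1 := by simpa using hi' 1 (by omega)
    obtain ⟨m, o, hio, ho, hm⟩ := exists_block g 0 (t := i + 1) (by rw [h1]; exact h01.symm)
    have hK : m.unpair.1 ∈ K := by
      by_contra hK
      simp [g, hK] at ho
    have hgm : g m = unaryWord m.unpair.1 := by simp [g, hK]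
    have hlen : (g m).length = m.unpair.1 + 3 := by rw [hgm, unaryWord_length]
    have hb : ∀ j, j < m.unpair.1 + 3 →
        blocks g 0 (2 ^ m + j) = if 1 ≤ j ∧ j ≤ m.unpair.1 + 1 then 1 else 0 := by
      intro j hj
      rw [blocks_inside g 0 hm j (by omega)]
      have : (g m)[j]'(by omega) = (unaryWord m.unpair.1)[j]'(by rw [unaryWord_length]; omega) := by
        simp [hgm]
      rw [this, unaryWord_getElem]
    have hbo := hb o (by omega)
    rw [← hio, h1] at hbo
    have hor : 1 ≤ o ∧ o ≤ m.unpair.1 + 1 := by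
      by_contra hc
      rw [if_neg hc] at hbo
      exact h01 hbo.symm
    have ho1 : o = 1 := by
      by_contra hne
      have e1 := hb (o - 1) (by omega)
      have e2 := hi' 0 (by omega)
      rw [if_pos (by omega), show 2 ^ m + (o - 1) = i + 0 by omega, e2] at e1
      simp at e1
    have him : i = 2 ^ m := by omega
    have : n = m.unpair.1 := by
      rcases lt_trichotomy n m.unpair.1 with h | h | h
      · have e1 := hi' (n + 2) (by omega)
        have e2 := hb (n + 2) (by omega)
        rw [if_neg (by omega)] at e1
        rw [if_pos (by omega), ← him, e1] at e2
        exact absurd e2 h01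
      · exact h
      · have e1 := hi' (m.unpair.1 + 2) (by omega)
        have e2 := hb (m.unpair.1 + 2) (by omega)
        rw [if_pos (by omega)] at e1
        rw [if_neg (by omega), ← him, e1] at e2
        exact absurd e2.symm h01
    rw [this]; exact hK
  · refine subword_blocks g 0 (unaryWord n) n fun m hm => ?_
    simp [g, hm, hn]

section Representations

variable {Ω : Type*} [MeasurableSpace Ω]

theorem MeasClass.eq_of_real_eq {C : CompSigmaAlgebra k Ω} {μ : Measure Ω}
    (hμ : IsComputableMeasure C μ) (A B : {A : Set Ω // MeasurableSet A})
    (h : ∀ v R, C.alpha v = some R → μ.real (R ∩ A.1) = μ.real (R ∩ B.1)) :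
    MeasClass.mk μ A = MeasClass.mk μ B := by
  have hR : ∀ R ∈ C.ring, μ (R ∩ A.1) = μ (R ∩ B.1) := by
    rintro R ⟨v, hv⟩
    have hfin : μ R < ⊤ := hμ.1 R ⟨v, hv⟩
    have h1 := (measure_mono (μ := μ) (Set.inter_subset_left (s := R) (t := A.1))).trans_lt hfin
    have h2 := (measure_mono (μ := μ) (Set.inter_subset_left (s := R) (t := B.1))).trans_lt hfin
    exact (ENNReal.toReal_eq_toReal_iff' h1.ne h2.ne).1 (h v R hv)
  have hmeas : ∀ R ∈ C.ring, MeasurableSet R := fun R hR => by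
    rw [C.generates]; exact MeasurableSpace.measurableSet_generateFrom hR
  have hcount : C.ring.Countable := by
    refine (Set.countable_range fun v => (C.alpha v).getD ∅).mono ?_
    rintro R ⟨v, hv⟩
    exact ⟨v, by simp [hv]⟩
  have hext : μ.restrict A.1 = μ.restrict B.1 := by
    refine Measure.ext_of_generateFrom_of_cover_subset (S := C.ring) (T := C.ring)
      C.generates ?_ le_rfl hcount C.sUnion_ring ?_ ?_
    · intro R hR' S hS _
      exact C.isSetRing.inter_mem hR' hS
    · intro R hR'
      rw [Measure.restrict_apply (hmeas R hR')]
      exact ((measure_mono Set.inter_subset_left).trans_lt (hμ.1 R hR')).ne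
    · intro R hR'
      rw [Measure.restrict_apply (hmeas R hR'), Measure.restrict_apply (hmeas R hR'), hR R hR']
  refine Quotient.sound (s := nullSetoid μ) ?_
  change μ (symmDiff A.1 B.1) = 0
  have e1 : μ (A.1 \ B.1) = 0 := by
    have := congrArg (fun ν : Measure Ω => ν (A.1 \ B.1)) hext
    simp only [Measure.restrict_apply (A.2.diff B.2)] at this
    rw [Set.inter_eq_left.2 Set.sdiff_subset] at this
    rw [this]; simp
  have e2 : μ (B.1 \ A.1) = 0 := by
    have := congrArg (fun ν : Measure Ω => ν (B.1 \ A.1)) hext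
    simp only [Measure.restrict_apply (B.2.diff A.2)] at this
    rw [Set.inter_eq_left.2 (Set.sdiff_subset (s := B.1) (t := A.1))] at this
    rw [← this]; simp
  exact measure_union_null e1 e2

/-- `ζ_+(p) = [A]` iff `p` is a list of all `⟨u, v⟩` such that `ν_ℚ(u) < μ(α(v) ∩ A)`. -/
def zetaPlus (C : CompSigmaAlgebra k Ω) (μ : Measure Ω) (hμ : IsComputableMeasure C μ) :
    NameRep k (MeasClass μ) where
  names p X := ∃ A, X = MeasClass.mk μ A ∧ listed p = plusWords C μ A.1
  unique := by
    rintro p _ _ ⟨A, rfl, hA⟩ ⟨B, rfl, hB⟩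
    refine MeasClass.eq_of_real_eq hμ A B fun v R hv => ?_
    have key : ∀ D E : Set Ω, plusWords C μ D = plusWords C μ E →
        μ.real (R ∩ D) ≤ μ.real (R ∩ E) := by
      intro D E h
      refine le_of_forall_rat_lt_imp_le fun q hq => ?_
      obtain ⟨u, hu⟩ := NuRat.surj (k := k) q
      have : tuple [u, v] ∈ plusWords C μ E := h ▸ ⟨u, v, q, R, rfl, hu, hv, hq⟩
      obtain ⟨u', v', a, R', e, hu', hv', hlt⟩ := this
      have e := tuple_inj e
      simp only [List.cons.injEq, and_true] at e
      obtain ⟨rfl, rfl⟩ := e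
      rw [hv] at hv'
      cases hv'
      rw [hu.unique hu']
      exact hlt.le
    exact le_antisymm (key _ _ (hA.symm.trans hB)) (key _ _ (hB.symm.trans hA))
  surj := by
    intro X
    obtain ⟨A, rfl⟩ := Quotient.exists_rep X
    obtain ⟨p, hp⟩ := listed_surj (plusWords C μ A.1)
    exact ⟨p, A, rfl, hp⟩

/-- `ζ_-(p) = [A]` iff `p` is a list of all `⟨v, w⟩` such that `μ(α(v) ∩ A) < ν_ℚ(w)`. -/
def zetaMinus (C : CompSigmaAlgebra k Ω) (μ : Measure Ω) (hμ : IsComputableMeasure C μ) :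
    NameRep k (MeasClass μ) where
  names p X := ∃ A, X = MeasClass.mk μ A ∧ listed p = minusWords C μ A.1
  unique := by
    rintro p _ _ ⟨A, rfl, hA⟩ ⟨B, rfl, hB⟩
    refine MeasClass.eq_of_real_eq hμ A B fun v R hv => ?_
    have key : ∀ D E : Set Ω, minusWords C μ D = minusWords C μ E →
        μ.real (R ∩ D) ≤ μ.real (R ∩ E) := by
      intro D E h
      refine le_of_forall_lt_rat_imp_le fun q hq => ?_
      obtain ⟨w, hw⟩ := NuRat.surj (k := k) q
      have : tuple [v, w] ∈ minusWords C μ D := h ▸ ⟨v, w, q, R, rfl, hv, hw, hq⟩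
      obtain ⟨v', w', b, R', e, hv', hw', hlt⟩ := this
      have e := tuple_inj e
      simp only [List.cons.injEq, and_true] at e
      obtain ⟨rfl, rfl⟩ := e
      rw [hv] at hv'
      cases hv'
      rw [hw.unique hw']
      exact hlt.le
    exact le_antisymm (key _ _ (hA.symm.trans hB)) (key _ _ (hB.symm.trans hA))
  surj := by
    intro X
    obtain ⟨A, rfl⟩ := Quotient.exists_rep X
    obtain ⟨p, hp⟩ := listed_surj (minusWords C μ A.1)
    exact ⟨p, A, rfl, hp⟩

/-- `ζ(p) = [A]` iff `p` is a list of all `⟨u, v, w⟩` such that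
`ν_ℚ(u) < μ(α(v) ∩ A) < ν_ℚ(w)`. -/
def zetaZero (C : CompSigmaAlgebra k Ω) (μ : Measure Ω) (hμ : IsComputableMeasure C μ) :
    NameRep k (MeasClass μ) where
  names p X := ∃ A, X = MeasClass.mk μ A ∧ listed p = zeroWords C μ A.1
  unique := by
    rintro p _ _ ⟨A, rfl, hA⟩ ⟨B, rfl, hB⟩
    refine MeasClass.eq_of_real_eq hμ A B fun v R hv => ?_
    have key : ∀ D E : Set Ω, zeroWords C μ D = zeroWords C μ E →
        μ.real (R ∩ D) ≤ μ.real (R ∩ E) := by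
      intro D E h
      refine le_of_forall_rat_lt_imp_le fun q hq => ?_
      obtain ⟨u, hu⟩ := NuRat.surj (k := k) q
      obtain ⟨b, hb⟩ := exists_rat_gt (μ.real (R ∩ D))
      obtain ⟨w, hw⟩ := NuRat.surj (k := k) b
      have : tuple [u, v, w] ∈ zeroWords C μ E := h ▸ ⟨u, v, w, q, b, R, rfl, hu, hv, hw, hq, hb⟩
      obtain ⟨u', v', w', a, b', R', e, hu', hv', hw', hlt, -⟩ := this
      have e := tuple_inj e
      simp only [List.cons.injEq, and_true] at e
      obtain ⟨rfl, rfl, rfl⟩ := e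
      rw [hv] at hv'
      cases hv'
      rw [hu.unique hu']
      exact hlt.le
    exact le_antisymm (key _ _ (hA.symm.trans hB)) (key _ _ (hB.symm.trans hA))
  surj := by
    intro X
    obtain ⟨A, rfl⟩ := Quotient.exists_rep X
    obtain ⟨p, hp⟩ := listed_surj (zeroWords C μ A.1)
    exact ⟨p, A, rfl, hp⟩

end Representations

/-! ## The problems that are compared -/

/-- The enumeration representation: `En(p) = {n | 01^{n+1}0 is a subword of p}`. -/
def En (k : ℕ) : NameRep k (Set ℕ) where
  names p K := enumerated p = K
  unique h h' := h.symm.trans h'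
  surj := enumerated_surj

/-- Complementation of enumerations `CE : (2^ℕ, En) → (2^ℕ, En)`, `K ↦ ℕ \ K`. -/
def CE (k : ℕ) : RepFun k (Set ℕ) (Set ℕ) where
  source := En k
  target := En k
  toFun K := Kᶜ

/-- The translation (identity function) from the representation `δ` to the representation `δ'`. -/
def translation {X : Type*} (δ δ' : NameRep k X) : RepFun k X X where
  source := δ
  target := δ'
  toFun := id

end TypeTwo

/-! ### Prefixes of sequences and their relation to subwords. -/

section Prefixes

variable {k : ℕ}

/-! A name in any of these representations is a list of a set of words, so it carries only positive
information. Each reduction therefore reduces to two tasks: writing the required set as one that is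
enumerable from the given names, and proving that the two sets are equal.

The first task is handled once and for all by `CERel`, the relations that are enumerable in two
sequences. They are closed under finite conjunction and disjunction, existential quantification and
bounded universal quantification, and `CERel.exists_computableMap₂` turns each of them into a total
computable map that lists it.

General measures. Every real number has rationals on both sides, so a two-sided name projects onto
either one-sided name. This gives the reductions of the one-sided translations to the two-sided
ones. Conversely, a lower and an upper list together yield a two-sided list. That merge has to
reread the original name, which is why it gives only a `LeW` reduction.

For the bound by `CE`, one application of complementation to a suitable set enumerated from `p`
makes both the listed and the unlisted words enumerable, without further access to `p`
(`exists_maps_of_complement`). Negative information about strict lower bounds gives the upper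
bounds: `μ(R ∩ A) < b` holds iff some rational `b' < b` fails to be a strict lower bound. Exchanging
the two sides treats `zetaMinus`.

Completeness. On the finite subsets of `ℕ` with positive weights on all points, an enumeration of
`K` approximates `μ(R ∩ K)` from below and `μ(R \ K)` from above by means of finite subsets of `K`.
A translation that supplies the missing side then reveals the nonmembers of `K`: `i ∉ K` iff `μ({i}
∩ K) < μ({i})`, and iff `0 < μ({i} ∩ Kᶜ)`. This reduces `CE` to the one-sided translations
(`CE_leSW_plus_minus`, `CE_leSW_minus_plus`), and transitivity of `LeSW` closes the circle. -/

theorem OmegaSeq.pre_length (p : OmegaSeq k) (n : ℕ) : (p.pre n).length = n := by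
  simp [OmegaSeq.pre]

theorem OmegaSeq.pre_getElem (p : OmegaSeq k) (n i : ℕ) (h : i < (p.pre n).length) :
    (p.pre n)[i] = p i := by
  simp [OmegaSeq.pre]

theorem OmegaSeq.pre_take (p : OmegaSeq k) {m n : ℕ} (h : m ≤ n) :
    (p.pre n).take m = p.pre m := by
  refine List.ext_getElem (by simp [OmegaSeq.pre, h]) fun i _ _ => by simp [OmegaSeq.pre]

theorem OmegaSeq.pre_prefix (p : OmegaSeq k) {m n : ℕ} (h : m ≤ n) : p.pre m <+: p.pre n := by
  rw [← p.pre_take h]; exact List.take_prefix _ _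

theorem OmegaSeq.eq_of_pre_prefix {p q : OmegaSeq k}
    (h : ∀ n, ∃ m, p.pre n <+: q.pre m) : p = q := by
  funext n
  obtain ⟨m, hm⟩ := h (n + 1)
  have h1 : n < (p.pre (n + 1)).length := by rw [OmegaSeq.pre_length]; omega
  have h2 := hm.getElem h1
  rwa [OmegaSeq.pre_getElem, OmegaSeq.pre_getElem] at h2

/-- Subwords of a sequence are the suffixes of its prefixes. -/
theorem subword_iff_suffix {w : Word k} {p : OmegaSeq k} :
    Subword w p ↔ ∃ n, w <:+ p.pre n := by
  constructor
  · rintro ⟨i, hi⟩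
    refine ⟨i + w.length, p.pre i, List.ext_getElem ?_ fun j h1 h2 => ?_⟩
    · simp [OmegaSeq.pre_length]
    · rw [OmegaSeq.pre_getElem]
      rcases Nat.lt_or_ge j i with h | h
      · rw [List.getElem_append_left (by rwa [OmegaSeq.pre_length]), OmegaSeq.pre_getElem]
      · rw [List.getElem_append_right (by rwa [OmegaSeq.pre_length])]
        simp only [OmegaSeq.pre_length] at h1 h2 ⊢
        rw [← hi (j - i) (by omega), Nat.add_sub_cancel' h]
  · rintro ⟨n, v, hv⟩
    refine ⟨v.length, fun j hj => ?_⟩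
    have h1 : v.length + j < (v ++ w).length := by simp [hj]
    have h2 : v.length + j < (p.pre n).length := hv ▸ h1
    rw [← OmegaSeq.pre_getElem p n _ h2]
    simp [← hv]

end Prefixes

/-! ### Primitive recursiveness of the coding functions. -/

section PrimrecLemmas

variable {k : ℕ} {α β : Type} [Primcodable α] [Primcodable β]

theorem primrec_wrap : Primrec (wrap : Word k → Word k) := by
  unfold wrap
  refine Primrec.list_append.comp (Primrec.list_append.comp (Primrec.const _)
    (Primrec.list_flatMap Primrec.id ?_)) (Primrec.const _)
  exact (Primrec.list_cons.comp (Primrec.const _)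
    (Primrec.list_cons.comp Primrec.snd (Primrec.const _))).to₂

theorem primrec_tuple : Primrec (tuple : List (Word k) → Word k) :=
  Primrec.list_flatMap Primrec.id (primrec_wrap.comp Primrec.snd).to₂

theorem primrec_unaryWord : Primrec (unaryWord : ℕ → Word k) := by
  refine (Primrec.list_append.comp (Primrec.list_append.comp (Primrec.const [0])
    (Primrec.list_map (Primrec.list_range.comp Primrec.succ)
      (Primrec.const (1 : Symb k)).to₂)) (Primrec.const [0])).of_eq fun n => ?_
  simp [unaryWord]

theorem primrec_nuNat : Primrec (nuNat : Word k → Option ℕ) := by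
  have h1 : PrimrecPred fun w : Word k => w = [0] ∨ (w.head? = some 1 ∧ ∀ a ∈ w, a = 0 ∨ a = 1) :=
    (Primrec.eq.comp Primrec.id (Primrec.const _)).or
      ((Primrec.eq.comp Primrec.list_head? (Primrec.const _)).and
        (PrimrecPred.forall_mem_list ((Primrec.eq.comp Primrec.id (Primrec.const _)).or
          (Primrec.eq.comp Primrec.id (Primrec.const _)))))
  have h2 : Primrec fun w : Word k => w.foldl (fun n a => 2 * n + a.val) 0 :=
    Primrec.list_foldl (h := fun _ (x : ℕ × Symb k) => 2 * x.1 + x.2.val) Primrec.id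
      (Primrec.const 0) ?_
  · exact Primrec.ite h1 (Primrec.option_some.comp h2) (Primrec.const _)
  exact (Primrec.nat_add.comp (Primrec.nat_mul.comp (Primrec.const 2)
    (Primrec.fst.comp Primrec.snd)) (Primrec.fin_val.comp (Primrec.snd.comp Primrec.snd))).to₂

theorem primrecRel_suffix : PrimrecRel (fun x w : List α => x <:+ w) := by
  refine PrimrecPred.of_eq (p := fun q : List α × List α =>
    q.2.drop (q.2.length - q.1.length) = q.1) ?_ fun q => ?_
  · exact Primrec.eq.comp (Primrec.list_drop.comp (Primrec.nat_sub.comp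
      (Primrec.list_length.comp Primrec.snd) (Primrec.list_length.comp Primrec.fst))
      Primrec.snd) Primrec.fst
  · exact eq_comm.trans List.suffix_iff_eq_drop.symm

theorem primrec_const_pow (b : ℕ) : Primrec (fun n : ℕ => b ^ n) := by
  refine (Primrec.nat_rec₁ (f := fun _ m => b * m) 1
    (Primrec.nat_mul.comp (Primrec.const b) Primrec.snd).to₂).of_eq fun n => ?_
  induction n with
  | zero => rfl
  | succ n ih => simp only [ih]; ring

theorem primrec_log_two : Primrec (fun n : ℕ => Nat.log 2 n) := by
  have h : PrimrecRel (fun t m : ℕ => 2 ^ m ≤ t) :=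
    Primrec.nat_le.comp ((primrec_const_pow 2).comp Primrec.snd) Primrec.fst
  refine (Primrec.nat_findGreatest Primrec.id h).of_eq fun n => ?_
  rcases Nat.eq_zero_or_pos n with rfl | hn
  · simp
  · refine le_antisymm ?_ ?_
    · exact Nat.le_log_of_pow_le (by norm_num)
        (Nat.findGreatest_spec (P := fun m => 2 ^ m ≤ n) (Nat.zero_le _)
          (by simpa using Nat.succ_le_of_lt hn))
    · exact Nat.le_findGreatest ((Nat.log_lt_self 2 hn.ne').le) (Nat.pow_log_le_self 2 hn.ne')

theorem primrec_blocks {g : α → ℕ → Word k} (hg : Primrec₂ g) (c : Symb k) :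
    Primrec₂ fun a t => blocks (g a) c t := by
  have hl : Primrec fun q : α × ℕ => Nat.log 2 q.2 := primrec_log_two.comp Primrec.snd
  have hgl : Primrec fun q : α × ℕ => g q.1 (Nat.log 2 q.2) := hg.comp Primrec.fst hl
  have hpow : Primrec fun q : α × ℕ => 2 ^ Nat.log 2 q.2 := (primrec_const_pow 2).comp hl
  refine Primrec.ite (((Primrec.eq.comp Primrec.snd (Primrec.const 0)).not).and
    (Primrec.nat_le.comp (Primrec.list_length.comp hgl) hpow)) ?_ (Primrec.const c)
  exact (Primrec.list_getD c).comp hgl (Primrec.nat_sub.comp Primrec.snd hpow)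

end PrimrecLemmas

/-! ### Relations enumerable in two sequences, and their closure properties. -/

section CERelations

variable {k : ℕ} {α β γ : Type} [Primcodable α] [Primcodable β] [Primcodable γ]

/-- `Q b p p'` is computably enumerable in the sequences `p` and `p'`, uniformly in `b`. -/
def CERel (Q : β → OmegaSeq k → OmegaSeq k → Prop) : Prop :=
  ∃ R : β × ℕ × Word k × Word k → Prop, PrimrecPred R ∧
    ∀ b p p', Q b p p' ↔ ∃ n, R (b, n, p.pre n, p'.pre n)

theorem CERel.of_iff {Q Q' : β → OmegaSeq k → OmegaSeq k → Prop} (h : CERel Q)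
    (H : ∀ b p p', Q' b p p' ↔ Q b p p') : CERel Q' := by
  obtain ⟨R, hR, e⟩ := h
  exact ⟨R, hR, fun b p p' => (H b p p').trans (e b p p')⟩

theorem CERel.of_primrecPred {T : β → Prop} (h : PrimrecPred T) :
    CERel (k := k) (fun b _ _ => T b) :=
  ⟨fun x => T x.1, h.comp Primrec.fst, fun b p p' => by simp⟩

theorem CERel.comp {Q : β → OmegaSeq k → OmegaSeq k → Prop} (h : CERel Q) {f : α → β}
    (hf : Primrec f) : CERel fun a => Q (f a) := by
  obtain ⟨R, hR, e⟩ := h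
  exact ⟨fun x => R (f x.1, x.2), hR.comp ((hf.comp Primrec.fst).pair Primrec.snd),
    fun a p p' => e (f a) p p'⟩

theorem CERel.swap {Q : β → OmegaSeq k → OmegaSeq k → Prop} (h : CERel Q) :
    CERel fun b p p' => Q b p' p := by
  obtain ⟨R, hR, e⟩ := h
  refine ⟨fun x => R (x.1, x.2.1, x.2.2.2, x.2.2.1), hR.comp ?_, fun b p p' => e b p' p⟩
  have h2 : Primrec fun x : β × ℕ × Word k × Word k => x.2.2 := Primrec.snd.comp Primrec.snd
  exact Primrec.fst.pair ((Primrec.fst.comp Primrec.snd).pair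
    ((Primrec.snd.comp h2).pair (Primrec.fst.comp h2)))

theorem CERel.or {Q Q' : β → OmegaSeq k → OmegaSeq k → Prop} (h : CERel Q) (h' : CERel Q') :
    CERel fun b p p' => Q b p p' ∨ Q' b p p' := by
  obtain ⟨R, hR, e⟩ := h
  obtain ⟨R', hR', e'⟩ := h'
  refine ⟨fun x => R x ∨ R' x, hR.or hR', fun b p p' => ?_⟩
  simp only [e, e', exists_or]

/-- Restriction of the stage and of the oracle prefixes. -/
theorem primrec_restrict {f : α → β} {g : α → ℕ} {w w' : α → Word k} (hf : Primrec f)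
    (hg : Primrec g) (hw : Primrec w) (hw' : Primrec w') :
    Primrec fun a => (f a, g a, (w a).take (g a), (w' a).take (g a)) :=
  hf.pair (hg.pair ((Primrec.list_take.comp hg hw).pair (Primrec.list_take.comp hg hw')))

/-- Dovetailing: a stage codes a candidate `c` together with a stage for `c`. The prefixes are cut
back to the inner stage because `R` need not be monotone in its stage. This is possible since the
components of a pair never exceed its code. -/
theorem CERel.exists {Q : β × γ → OmegaSeq k → OmegaSeq k → Prop} (h : CERel Q) :
    CERel fun b p p' => ∃ c, Q (b, c) p p' := by
  obtain ⟨R, hR, e⟩ := h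
  refine ⟨fun x => ∃ c ∈ (Encodable.decode x.2.1.unpair.1 : Option γ).toList,
    R ((x.1, c), x.2.1.unpair.2, x.2.2.1.take x.2.1.unpair.2, x.2.2.2.take x.2.1.unpair.2),
    ?_, fun b p p' => ?_⟩
  · have hn : Primrec fun x : β × ℕ × Word k × Word k => x.2.1.unpair :=
      Primrec.unpair.comp (Primrec.fst.comp Primrec.snd)
    have hrel : PrimrecRel fun (c : γ) (x : β × ℕ × Word k × Word k) =>
        R ((x.1, c), x.2.1.unpair.2, x.2.2.1.take x.2.1.unpair.2,
          x.2.2.2.take x.2.1.unpair.2) := by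
      refine hR.comp (primrec_restrict
        ((Primrec.fst.comp Primrec.snd).pair Primrec.fst)
        (Primrec.snd.comp (hn.comp Primrec.snd)) ?_ ?_)
      · exact Primrec.fst.comp (Primrec.snd.comp (Primrec.snd.comp Primrec.snd))
      · exact Primrec.snd.comp (Primrec.snd.comp (Primrec.snd.comp Primrec.snd))
    exact hrel.exists_mem_list.comp
      (Primrec.optionToList.comp (Primrec.decode.comp (Primrec.fst.comp hn))) Primrec.id
  · constructor
    · rintro ⟨c, hc⟩
      obtain ⟨n, hn⟩ := (e _ _ _).1 hc
      refine ⟨Nat.pair (Encodable.encode c) n, c, by simp, ?_⟩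
      simpa [OmegaSeq.pre_take _ (Nat.right_le_pair _ _)] using hn
    · rintro ⟨n, c, -, hn⟩
      refine ⟨c, (e _ _ _).2 ⟨n.unpair.2, ?_⟩⟩
      simpa [OmegaSeq.pre_take _ (Nat.unpair_right_le _)] using hn

theorem CERel.forall_lt {Q : β × ℕ → OmegaSeq k → OmegaSeq k → Prop} (h : CERel Q) {f : β → ℕ}
    (hf : Primrec f) : CERel fun b p p' => ∀ i < f b, Q (b, i) p p' := by
  obtain ⟨R, hR, e⟩ := h
  refine ⟨fun x => ∀ i < f x.1, ∃ n < x.2.1 + 1, R ((x.1, i), n, x.2.2.1.take n, x.2.2.2.take n),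
    ?_, fun b p p' => ?_⟩
  · have hrel : PrimrecRel fun (n : ℕ) (y : ℕ × β × ℕ × Word k × Word k) =>
        R ((y.2.1, y.1), n, y.2.2.2.1.take n, y.2.2.2.2.take n) := by
      have h1 : Primrec fun q : ℕ × ℕ × β × ℕ × Word k × Word k => q.2.2 :=
        Primrec.snd.comp Primrec.snd
      have h2 : Primrec fun q : ℕ × ℕ × β × ℕ × Word k × Word k => q.2.2.2.2 :=
        Primrec.snd.comp (Primrec.snd.comp h1)
      exact hR.comp (primrec_restrict
        ((Primrec.fst.comp h1).pair (Primrec.fst.comp Primrec.snd))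
        Primrec.fst (Primrec.fst.comp h2) (Primrec.snd.comp h2))
    have hlt : Primrec fun y : ℕ × β × ℕ × Word k × Word k => List.range (y.2.2.1 + 1) :=
      Primrec.list_range.comp (Primrec.succ.comp (Primrec.fst.comp (Primrec.snd.comp Primrec.snd)))
    have hrel2 : PrimrecRel fun (i : ℕ) (x : β × ℕ × Word k × Word k) =>
        ∃ n < x.2.1 + 1, R ((x.1, i), n, x.2.2.1.take n, x.2.2.2.take n) :=
      PrimrecPred.of_eq (hrel.exists_mem_list.comp hlt Primrec.id) fun _ => by simp
    exact PrimrecPred.of_eq (hrel2.forall_mem_list.comp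
      (Primrec.list_range.comp (hf.comp Primrec.fst)) Primrec.id) fun _ => by simp
  · constructor
    · intro hq
      choose! n hn using fun i hi => (e _ _ _).1 (hq i hi)
      -- Finitely many witnesses have a common bound, and stage `m` of the new relation tries all
      -- inner stages up to `m`.
      refine ⟨(Finset.range (f b)).sup n, fun i hi => ⟨n i, ?_, ?_⟩⟩
      · exact Nat.lt_succ_of_le (Finset.le_sup (Finset.mem_range.2 hi))
      · have : n i ≤ (Finset.range (f b)).sup n := Finset.le_sup (Finset.mem_range.2 hi)
        simpa [OmegaSeq.pre_take _ this] using hn i hi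
    · rintro ⟨m, hm⟩ i hi
      obtain ⟨n, hn, hR'⟩ := hm i hi
      refine (e _ _ _).2 ⟨n, ?_⟩
      simpa [OmegaSeq.pre_take _ (Nat.le_of_lt_succ hn)] using hR'

theorem CERel.and {Q Q' : β → OmegaSeq k → OmegaSeq k → Prop} (h : CERel Q) (h' : CERel Q') :
    CERel fun b p p' => Q b p p' ∧ Q' b p p' := by
  obtain ⟨R, hR, e⟩ := h
  obtain ⟨R', hR', e'⟩ := h'
  have hw : Primrec fun x : β × ℕ × Word k × Word k => x.2.2.1 :=
    Primrec.fst.comp (Primrec.snd.comp Primrec.snd)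
  have hw' : Primrec fun x : β × ℕ × Word k × Word k => x.2.2.2 :=
    Primrec.snd.comp (Primrec.snd.comp Primrec.snd)
  have hn : Primrec fun x : β × ℕ × Word k × Word k => x.2.1.unpair :=
    Primrec.unpair.comp (Primrec.fst.comp Primrec.snd)
  refine ⟨fun x => R (x.1, x.2.1.unpair.1, x.2.2.1.take x.2.1.unpair.1,
      x.2.2.2.take x.2.1.unpair.1) ∧ R' (x.1, x.2.1.unpair.2, x.2.2.1.take x.2.1.unpair.2,
      x.2.2.2.take x.2.1.unpair.2),
    (hR.comp (primrec_restrict Primrec.fst (Primrec.fst.comp hn) hw hw')).and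
      (hR'.comp (primrec_restrict Primrec.fst (Primrec.snd.comp hn) hw hw')), fun b p p' => ?_⟩
  simp only [e, e']
  constructor
  · rintro ⟨⟨n, hn⟩, ⟨n', hn'⟩⟩
    refine ⟨Nat.pair n n', ?_⟩
    simpa [OmegaSeq.pre_take _ (Nat.left_le_pair _ _), OmegaSeq.pre_take _ (Nat.right_le_pair _ _)]
      using And.intro hn hn'
  · rintro ⟨n, h1, h2⟩
    refine ⟨⟨n.unpair.1, ?_⟩, ⟨n.unpair.2, ?_⟩⟩
    · simpa [OmegaSeq.pre_take _ (Nat.unpair_left_le _)] using h1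
    · simpa [OmegaSeq.pre_take _ (Nat.unpair_right_le _)] using h2

/-- Decidable properties of a prefix of the first sequence. -/
theorem CERel.of_pre {T : β → Word k → Prop} (hT : PrimrecRel T) {f : β → ℕ} (hf : Primrec f) :
    CERel fun b (p _ : OmegaSeq k) => T b (p.pre (f b)) := by
  -- Stage `n` sees only `n` symbols, so it stays silent until the required prefix is available.
  refine ⟨fun x => f x.1 ≤ x.2.1 ∧ T x.1 (x.2.2.1.take (f x.1)),
    (Primrec.nat_le.comp (hf.comp Primrec.fst) (Primrec.fst.comp Primrec.snd)).and
      (hT.comp Primrec.fst (Primrec.list_take.comp (hf.comp Primrec.fst)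
        (Primrec.fst.comp (Primrec.snd.comp Primrec.snd)))), fun b p p' => ?_⟩
  constructor
  · intro h
    exact ⟨f b, le_rfl, by simpa [OmegaSeq.pre_take] using h⟩
  · rintro ⟨n, hn, h⟩
    simpa [OmegaSeq.pre_take _ hn] using h

theorem CERel.subword {f : β → Word k} (hf : Primrec f) :
    CERel fun b (p _ : OmegaSeq k) => Subword (f b) p := by
  have h : CERel fun (b : β × ℕ) (p _ : OmegaSeq k) => f b.1 <:+ p.pre b.2 :=
    CERel.of_pre (T := fun (b : β × ℕ) w => f b.1 <:+ w)
      (primrecRel_suffix.comp (hf.comp (Primrec.fst.comp Primrec.fst)) Primrec.snd) Primrec.snd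
  exact h.exists.of_iff fun b p p' => subword_iff_suffix

theorem CERel.mem_listed {f : β → Word k} (hf : Primrec f) :
    CERel fun b (p _ : OmegaSeq k) => f b ∈ listed p :=
  CERel.subword (primrec_wrap.comp hf)

theorem CERel.mem_enumerated {f : β → ℕ} (hf : Primrec f) :
    CERel fun b (p _ : OmegaSeq k) => f b ∈ enumerated p :=
  CERel.subword (primrec_unaryWord.comp hf)

end CERelations

/-! ### Machines that list enumerable sets. -/

section Listings

variable {k : ℕ} {β γ : Type} [Primcodable β] [Primcodable γ]

/-- The words `ε b` can be written, separated by symbols `c`, without creating other words `ε b'`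
as subwords. -/
structure Framing (ε : β → Word k) (c : Symb k) : Prop where
  primrec : Primrec ε
  sound : ∀ (g : ℕ → Word k) (W : Set β), (∀ m, g m = [] ∨ ∃ b ∈ W, g m = ε b) →
    ∀ b, Subword (ε b) (blocks g c) → b ∈ W

/-- The filler is `1`, so the first `0` of an occurrence of `wrap x` lies inside some written `wrap
w`. In `wrap w` the even offsets from 2 to `2 * w.length + 2` carry `0`, whereas `wrap x` starts and
ends with `11`. The start forces the two words to be aligned, the end forces them to have equal
length. -/
theorem framing_wrap : Framing (wrap : Word k → Word k) 1 := by
  refine ⟨primrec_wrap, fun g W hg x => ?_⟩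
  rintro ⟨i, hi⟩
  have hi' : ∀ j a, (wrap x)[j]? = some a → blocks g 1 (i + j) = a := by
    intro j a h
    obtain ⟨hj, rfl⟩ := List.getElem?_eq_some_iff.1 h
    exact hi j hj
  obtain ⟨x0, x1, xe, xo, xl, xl'⟩ := wrap_getElem? x
  have h2 : blocks g 1 (i + 2) = 0 := hi' 2 0 (xe 0 (Nat.zero_le _))
  obtain ⟨m, o, hio, ho, hm⟩ := exists_block g 1 (t := i + 2) (by rw [h2]; simp)
  obtain ⟨w, hwW, hgw⟩ := (hg m).resolve_left fun h => by simp [h] at ho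
  obtain ⟨w0, w1, we, wo, wl, wl'⟩ := wrap_getElem? w
  have hb : ∀ j a, (wrap w)[j]? = some a → blocks g 1 (2 ^ m + j) = a := by
    intro j a h
    obtain ⟨hj, rfl⟩ := List.getElem?_eq_some_iff.1 h
    rw [blocks_inside g 1 hm j (by rw [hgw]; exact hj)]
    simp [hgw]
  have hlen : (g m).length = 2 * w.length + 5 := by rw [hgw, wrap_length]
  have h01 : (0 : Symb k) ≠ 1 := by simp
  have hzero : ∀ j, 2 ≤ j → j % 2 = 0 → j ≤ 2 * w.length + 2 → blocks g 1 (2 ^ m + j) = 0 := by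
    intro j h1 h2 h3
    have := hb (2 * (j / 2 - 1) + 2) 0 (we (j / 2 - 1) (by omega))
    rwa [show 2 * (j / 2 - 1) + 2 = j by omega] at this
  -- Otherwise one of the two symbols `1` that open `wrap x` would fall on an even offset of `wrap
  -- w` that carries `0`: its first symbol if `o` is even, its second if `o` is odd.
  have ho2 : o = 2 := by
    by_contra hne
    have hA : blocks g 1 (2 ^ m + o) = 0 := by rw [← hio]; exact h2
    have hB := hi' 0 1 x0
    have hC := hi' 1 1 x1
    have hoE : o ≤ 2 * w.length + 2 := by
      by_contra hlt
      have : o = 2 * w.length + 3 ∨ o = 2 * w.length + 4 := by omega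
      rcases this with h | h
      · rw [h, hb _ _ wl] at hA; exact h01 hA.symm
      · rw [h, hb _ _ wl'] at hA; exact h01 hA.symm
    rcases Nat.lt_or_ge o 2 with h | h
    · have : o = 0 ∨ o = 1 := by omega
      rcases this with h | h
      · rw [h, hb _ _ w0] at hA; exact h01 hA.symm
      · rw [h, hb _ _ w1] at hA; exact h01 hA.symm
    · rcases Nat.mod_two_eq_zero_or_one o with e | e
      · have := hzero (o - 2) (by omega) (by omega) (by omega)
        rw [show 2 ^ m + (o - 2) = i + 0 by omega, hB] at this
        exact h01 this.symm
      · have := hzero (o - 1) (by omega) (by omega) (by omega)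
        rw [show 2 ^ m + (o - 1) = i + 1 by omega, hC] at this
        exact h01 this.symm
  have him : i = 2 ^ m := by omega
  rw [him] at hi'
  -- The last `1` of the shorter word would sit on a separator `0` of the longer one.
  have hxw : x.length = w.length := by
    rcases lt_trichotomy x.length w.length with h | h | h
    · have h1 := hi' _ _ xl'
      have h3 := hzero (2 * x.length + 4) (by omega) (by omega) (by omega)
      rw [h1] at h3; exact absurd h3.symm h01
    · exact h
    · have h1 := hb _ _ wl'
      have h3 := hi' _ _ (xe (w.length + 1) (by omega))
      rw [show 2 * (w.length + 1) + 2 = 2 * w.length + 4 by ring, h1] at h3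
      exact absurd h3.symm h01
  have : x = w := by
    refine List.ext_getElem hxw fun j h1 h2 => ?_
    have e1 := hi' (2 * j + 3) x[j] (by rw [xo j h1, List.getElem?_eq_getElem h1])
    have e2 := hb (2 * j + 3) w[j] (by rw [wo j h2, List.getElem?_eq_getElem h2])
    rw [← e1, ← e2]
  rw [this]; exact hwW

/-- The filler is `0`, so the first `1` of an occurrence lies in a written word. Since it is
preceded by `0`, it opens the run of that word, and the lengths of the two runs must agree. -/
theorem framing_unaryWord : Framing (unaryWord : ℕ → Word k) 0 := by
  refine ⟨primrec_unaryWord, fun g K hg n => ?_⟩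
  rintro ⟨i, hi⟩
  have h01 : (0 : Symb k) ≠ 1 := by simp
  have hi' : ∀ j, j < n + 3 → blocks g 0 (i + j) = if 1 ≤ j ∧ j ≤ n + 1 then 1 else 0 := by
    intro j hj
    rw [hi j (by rw [unaryWord_length]; exact hj), unaryWord_getElem]
  have h1 : blocks g 0 (i + 1) = 1 := by simpa using hi' 1 (by omega)
  obtain ⟨m, o, hio, ho, hm⟩ := exists_block g 0 (t := i + 1) (by rw [h1]; exact h01.symm)
  obtain ⟨l, hK, hgm⟩ := (hg m).resolve_left fun h => by simp [h] at ho
  have hlen : (g m).length = l + 3 := by rw [hgm, unaryWord_length]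
  have hb : ∀ j, j < l + 3 →
      blocks g 0 (2 ^ m + j) = if 1 ≤ j ∧ j ≤ l + 1 then 1 else 0 := by
    intro j hj
    rw [blocks_inside g 0 hm j (by omega)]
    have : (g m)[j]'(by omega) = (unaryWord l)[j]'(by rw [unaryWord_length]; omega) := by
      simp [hgm]
    rw [this, unaryWord_getElem]
  have hbo := hb o (by omega)
  rw [← hio, h1] at hbo
  have hor : 1 ≤ o ∧ o ≤ l + 1 := by
    by_contra hc
    rw [if_neg hc] at hbo
    exact h01 hbo.symm
  have ho1 : o = 1 := by
    by_contra hne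
    have e1 := hb (o - 1) (by omega)
    have e2 := hi' 0 (by omega)
    rw [if_pos (by omega), show 2 ^ m + (o - 1) = i + 0 by omega, e2] at e1
    simp at e1
  have him : i = 2 ^ m := by omega
  have : n = l := by
    rcases lt_trichotomy n l with h | h | h
    · have e1 := hi' (n + 2) (by omega)
      have e2 := hb (n + 2) (by omega)
      rw [if_neg (by omega)] at e1
      rw [if_pos (by omega), ← him, e1] at e2
      exact absurd e2 h01
    · exact h
    · have e1 := hi' (l + 2) (by omega)
      have e2 := hb (l + 2) (by omega)
      rw [if_pos (by omega)] at e1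
      rw [if_neg (by omega), ← him, e1] at e2
      exact absurd e2.symm h01
  rw [this]; exact hK

open Classical in
/-- The word that is written at stage `m`: if `m` codes `b` and `n` such that `R (b, n, a)`
then it is `ε b`. -/
noncomputable def stageWord (R : β × ℕ × γ → Prop) (ε : β → Word k) (a : γ) (m : ℕ) : Word k :=
  (Encodable.decode m.unpair.1.unpair.1 : Option β).casesOn []
    fun b => if R (b, m.unpair.1.unpair.2, a) then ε b else []

theorem primrec_stageWord {R : β × ℕ × γ → Prop} (hR : PrimrecPred R) {ε : β → Word k}
    (hε : Primrec ε) : Primrec₂ (stageWord R ε) := by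
  classical
  have hu : Primrec fun q : γ × ℕ => q.2.unpair.1.unpair :=
    Primrec.unpair.comp (Primrec.fst.comp (Primrec.unpair.comp Primrec.snd))
  have hx : Primrec fun q : (γ × ℕ) × β => (q.2, q.1.2.unpair.1.unpair.2, q.1.1) :=
    Primrec.snd.pair (((Primrec.snd.comp hu).comp Primrec.fst).pair
      (Primrec.fst.comp Primrec.fst))
  exact Primrec.option_casesOn (Primrec.decode.comp (Primrec.fst.comp hu)) (Primrec.const [])
    (Primrec.ite (hR.comp hx) (hε.comp Primrec.snd) (Primrec.const [])).to₂

/-- The first component of `m` codes the pair of `b` and `n`. The second is padding: it lets every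
pair recur at indices so large that the word fits into the block of length `2 ^ m`. As `n ≤ m` for
the coded `n`, it suffices that the data `a m` decide stages up to `m`, which prefixes of length `m`
do. -/
theorem subword_blocks_stageWord {δ : Type} {ε : β → Word k} {c : Symb k} (hε : Framing ε c)
    {R : β × ℕ × δ → Prop} {T : β → ℕ → Prop} {a : ℕ → δ}
    (h : ∀ b n m, n ≤ m → (R (b, n, a m) ↔ T b n)) (b : β) :
    Subword (ε b) (blocks (fun m => stageWord R ε (a m) m) c) ↔ ∃ n, T b n := by
  constructor
  · refine hε.sound _ {b | ∃ n, T b n} (fun m => ?_) b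
    unfold stageWord
    cases Encodable.decode (α := β) m.unpair.1.unpair.1 with
    | none => exact Or.inl rfl
    | some b =>
      dsimp only
      split_ifs with hR
      · exact Or.inr ⟨b, ⟨_, (h _ _ _ ((Nat.unpair_right_le _).trans (Nat.unpair_left_le _))).1 hR⟩,
          rfl⟩
      · exact Or.inl rfl
  · rintro ⟨n, hn⟩
    refine subword_blocks _ c _ (Nat.pair (Encodable.encode b) n) fun m hm => ?_
    have hnm : n ≤ m := (Nat.right_le_pair (Encodable.encode b) n).trans
      (hm ▸ Nat.unpair_left_le m)
    simp [stageWord, hm, (h b n m hnm).2 hn]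

/-- Since position `t` belongs to the block with index `Nat.log 2 t`, finitely many stages fix a
whole initial segment of the output. This makes the machine below monotone. -/
theorem blocks_congr {g g' : ℕ → Word k} (c : Symb k) {N : ℕ} (h : ∀ m ≤ N, g m = g' m) {t : ℕ}
    (ht : t < 2 ^ N) : blocks g c t = blocks g' c t := by
  have : Nat.log 2 t ≤ N := by
    rcases Nat.eq_zero_or_pos t with rfl | h0
    · simp
    · exact (Nat.log_lt_of_lt_pow h0.ne' ht).le
  simp only [blocks, h _ this]

/-- The total map `H` of two sequences is computable. -/
def ComputableMap₂ (H : OmegaSeq k → OmegaSeq k → OmegaSeq k) : Prop :=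
  ComputableSeqFun₂ fun p p' => Part.some (H p p')

/-- The total map `G` is computable. -/
def ComputableMap (G : OmegaSeq k → OmegaSeq k) : Prop :=
  ComputableSeqFun fun p => Part.some (G p)

theorem ComputableMap₂.diag {H : OmegaSeq k → OmegaSeq k → OmegaSeq k} (h : ComputableMap₂ H) :
    ComputableMap fun p => H p p := by
  obtain ⟨φ, hφ, hm, hq⟩ := h
  exact ⟨fun w => φ w w, hφ.comp Computable.id Computable.id, fun v w h => hm _ _ _ _ h h,
    fun p q => hq p p q⟩

theorem computableMap_id : ComputableMap (k := k) id := by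
  refine ⟨id, Computable.id, fun v w h => h, fun p q => ?_⟩
  simp only [id, Part.mem_some_iff]
  exact ⟨fun h n => ⟨n, h ▸ List.prefix_rfl⟩, fun h => OmegaSeq.eq_of_pre_prefix h⟩

/-- Sets that are computably enumerable in `p` and `p'` can be listed by a machine. -/
theorem CERel.exists_computableMap₂ {Q : β → OmegaSeq k → OmegaSeq k → Prop} (hQ : CERel Q)
    {ε : β → Word k} {c : Symb k} (hε : Framing ε c) :
    ∃ H : OmegaSeq k → OmegaSeq k → OmegaSeq k, ComputableMap₂ H ∧
      ∀ p p' b, Subword (ε b) (H p p') ↔ Q b p p' := by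
  obtain ⟨R, hR, e⟩ := hQ
  let R' : β × ℕ × Word k × Word k → Prop :=
    fun x => R (x.1, x.2.1, x.2.2.1.take x.2.1, x.2.2.2.take x.2.1)
  have hR' : PrimrecPred R' := hR.comp (primrec_restrict Primrec.fst
    (Primrec.fst.comp Primrec.snd) (Primrec.fst.comp (Primrec.snd.comp Primrec.snd))
    (Primrec.snd.comp (Primrec.snd.comp Primrec.snd)))
  let out : OmegaSeq k → OmegaSeq k → OmegaSeq k := fun p p' =>
    blocks (fun m => stageWord R' ε (p.pre m, p'.pre m) m) c
  let g : Word k × Word k → ℕ → Word k := fun a m => stageWord R' ε (a.1.take m, a.2.take m) m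
  -- Blocks with index up to `m` read at most `m` symbols of each input, so the common input length
  -- determines this many output symbols.
  let φ : Word k → Word k → Word k := fun w w' =>
    (List.range (2 ^ min w.length w'.length)).map (blocks (g (w, w')) c)
  have hg : Primrec₂ g := (primrec_stageWord hR' hε.primrec).comp
    ((Primrec.list_take.comp Primrec.snd (Primrec.fst.comp Primrec.fst)).pair
      (Primrec.list_take.comp Primrec.snd (Primrec.snd.comp Primrec.fst))) Primrec.snd
  have hφ : Primrec₂ φ := by
    refine Primrec.list_map (Primrec.list_range.comp ((primrec_const_pow 2).comp
      (Primrec.nat_min.comp (Primrec.list_length.comp Primrec.fst)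
        (Primrec.list_length.comp Primrec.snd)))) ?_
    exact primrec_blocks hg c
  have hφpre : ∀ p p' m, φ (p.pre m) (p'.pre m) = (out p p').pre (2 ^ m) := by
    intro p p' m
    simp only [φ, OmegaSeq.pre_length, min_self]
    refine List.map_congr_left fun t ht => blocks_congr c (fun m' hm' => ?_) (List.mem_range.1 ht)
    simp only [g, OmegaSeq.pre_take _ hm']
  refine ⟨out, ⟨φ, hφ.to_comp, ?_, ?_⟩, ?_⟩
  · intro v w v' w' h h'
    have hle : min v.length v'.length ≤ min w.length w'.length :=
      min_le_min h.length_le h'.length_le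
    have : φ v v' = (φ w w').take (2 ^ min v.length v'.length) := by
      simp only [φ, ← List.map_take, List.take_range,
        min_eq_left (Nat.pow_le_pow_right two_pos hle)]
      refine List.map_congr_left fun t ht =>
        blocks_congr c (fun m hm => ?_) (List.mem_range.1 ht)
      have h1 : v.take m = w.take m := by
        obtain ⟨r, rfl⟩ := h
        rw [List.take_append_of_le_length (hm.trans (min_le_left _ _))]
      have h2 : v'.take m = w'.take m := by
        obtain ⟨r, rfl⟩ := h'
        rw [List.take_append_of_le_length (hm.trans (min_le_right _ _))]
      simp only [g, h1, h2]
    rw [this]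
    exact List.take_prefix _ _
  · intro p p' q
    simp only [hφpre, Part.mem_some_iff]
    constructor
    · rintro rfl n
      exact ⟨n, OmegaSeq.pre_prefix _ Nat.lt_two_pow_self.le⟩
    · intro h
      exact OmegaSeq.eq_of_pre_prefix fun n => (h n).imp' _ fun _ hm => hm
  · intro p p' b
    rw [e]
    refine subword_blocks_stageWord hε (T := fun b n => R (b, n, p.pre n, p'.pre n))
      (fun b n m h => ?_) b
    simp only [R', OmegaSeq.pre_take _ h]

theorem CERel.exists_listed₂ {Q : Word k → OmegaSeq k → OmegaSeq k → Prop} (hQ : CERel Q) :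
    ∃ H : OmegaSeq k → OmegaSeq k → OmegaSeq k, ComputableMap₂ H ∧
      ∀ p p', listed (H p p') = {x | Q x p p'} := by
  obtain ⟨H, hH, h⟩ := hQ.exists_computableMap₂ framing_wrap
  exact ⟨H, hH, fun p p' => Set.ext fun x => h p p' x⟩

theorem CERel.exists_listed {Q : Word k → OmegaSeq k → OmegaSeq k → Prop} (hQ : CERel Q) :
    ∃ G : OmegaSeq k → OmegaSeq k, ComputableMap G ∧ ∀ p, listed (G p) = {x | Q x p p} := by
  obtain ⟨H, hH, h⟩ := hQ.exists_listed₂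
  exact ⟨_, hH.diag, fun p => h p p⟩

theorem CERel.exists_enumerated {Q : ℕ → OmegaSeq k → OmegaSeq k → Prop} (hQ : CERel Q) :
    ∃ G : OmegaSeq k → OmegaSeq k, ComputableMap G ∧ ∀ p, enumerated (G p) = {n | Q n p p} := by
  obtain ⟨H, hH, h⟩ := hQ.exists_computableMap₂ framing_unaryWord
  exact ⟨_, hH.diag, fun p => Set.ext fun n => h p p n⟩

/-- Uniformly computably enumerable sets of words have uniformly computable lists. -/
theorem CERel.exists_primrec_listed {Q : Word k × γ → Prop}
    (hQ : CERel (k := k) fun b _ _ => Q b) :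
    ∃ r : γ → OmegaSeq k, Primrec₂ r ∧ ∀ a, listed (r a) = {x | Q (x, a)} := by
  obtain ⟨R, hR, e⟩ := hQ
  -- `Q` does not depend on the sequences, so the prefixes of the zero sequence serve as dummy
  -- inputs.
  let z : ℕ → Word k := fun n => (List.range n).map fun _ => 0
  have hz : Primrec z := Primrec.list_map Primrec.list_range (Primrec.const (0 : Symb k)).to₂
  let R' : Word k × ℕ × γ → Prop := fun x => R ((x.1, x.2.2), x.2.1, z x.2.1, z x.2.1)
  have hn : Primrec fun x : Word k × ℕ × γ => x.2.1 := Primrec.fst.comp Primrec.snd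
  have hR' : PrimrecPred R' := hR.comp
    ((Primrec.fst.pair (Primrec.snd.comp Primrec.snd)).pair
      (hn.pair ((hz.comp hn).pair (hz.comp hn))))
  refine ⟨fun a => blocks (stageWord R' wrap a) 1,
    primrec_blocks (primrec_stageWord hR' primrec_wrap) 1, fun a => Set.ext fun x => ?_⟩
  refine (subword_blocks_stageWord framing_wrap (T := fun x n => R' (x, n, a))
    (a := fun _ => a) (fun _ _ _ _ => Iff.rfl) x).trans ?_
  exact (e (x, a) (fun _ => 0) (fun _ => 0)).symm

end Listings

/-! ### Composing reductions. -/

section Reductions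

variable {k : ℕ} {X Y X' Y' X'' Y'' : Type*}

theorem RepFun.leSW_of_maps {f : RepFun k X Y} {g : RepFun k X' Y'} {G H : OmegaSeq k → OmegaSeq k}
    (hG : ComputableMap G) (hH : ComputableMap H)
    (h : ∀ p x, f.source.names p x → ∃ x', g.source.names (G p) x' ∧
      ∀ r, g.target.names r (g.toFun x') → f.target.names (H r) (f.toFun x)) : f.LeSW g := by
  refine ⟨_, _, hG, hH, fun F hF p x hp => ?_⟩
  obtain ⟨x', h1, h2⟩ := h p x hp
  obtain ⟨r, hr, hr'⟩ := hF _ _ h1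
  refine ⟨H r, ?_, h2 r hr'⟩
  exact Part.mem_bind_iff.2
    ⟨r, Part.mem_bind_iff.2 ⟨G p, Part.mem_some _, hr⟩, Part.mem_some _⟩

theorem RepFun.leW_of_maps {f : RepFun k X Y} {g : RepFun k X' Y'} {G : OmegaSeq k → OmegaSeq k}
    {H : OmegaSeq k → OmegaSeq k → OmegaSeq k} (hG : ComputableMap G) (hH : ComputableMap₂ H)
    (h : ∀ p x, f.source.names p x → ∃ x', g.source.names (G p) x' ∧
      ∀ r, g.target.names r (g.toFun x') → f.target.names (H p r) (f.toFun x)) : f.LeW g := by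
  refine ⟨_, _, hG, hH, fun F hF p x hp => ?_⟩
  obtain ⟨x', h1, h2⟩ := h p x hp
  obtain ⟨r, hr, hr'⟩ := hF _ _ h1
  refine ⟨H p r, ?_, h2 r hr'⟩
  exact Part.mem_bind_iff.2
    ⟨r, Part.mem_bind_iff.2 ⟨G p, Part.mem_some _, hr⟩, Part.mem_some _⟩

/-- Chaining the two word functions may produce an infinite output even where the intermediate
output stays finite. The resulting map is thus in general a proper extension of the composition. An
extension is enough, because realizers are constrained only on names. -/
theorem ComputableSeqFun.comp {G' G : OmegaSeq k →. OmegaSeq k} (hG' : ComputableSeqFun G')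
    (hG : ComputableSeqFun G) :
    ∃ K : OmegaSeq k →. OmegaSeq k, ComputableSeqFun K ∧ ∀ p r, r ∈ (G p).bind G' → r ∈ K p := by
  obtain ⟨φ', hφ', hm', h'⟩ := hG'
  obtain ⟨φ, hφ, hm, h⟩ := hG
  let ψ : Word k → Word k := fun w => φ' (φ w)
  have hψ : ∀ v w, v <+: w → ψ v <+: ψ w := fun v w hvw => hm' _ _ (hm _ _ hvw)
  let P : OmegaSeq k → OmegaSeq k → Prop := fun p q => ∀ n, ∃ m, q.pre n <+: ψ (p.pre m)
  -- By monotonicity all outputs on prefixes of `p` are comparable, so they have at most one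
  -- infinite limit. Hence the choice in the definition of the map is harmless.
  have huniq : ∀ p q q', P p q → P p q' → q = q' := by
    intro p q q' hq hq'
    refine OmegaSeq.eq_of_pre_prefix fun n => ⟨n, ?_⟩
    obtain ⟨m, hm⟩ := hq n
    obtain ⟨m', hm'⟩ := hq' n
    exact List.prefix_of_prefix_length_le
      (hm.trans (hψ _ _ (p.pre_prefix (le_max_left m m'))))
      (hm'.trans (hψ _ _ (p.pre_prefix (le_max_right m m'))))
      (by simp [OmegaSeq.pre_length])
  have hmem : ∀ p q, (q ∈ (⟨∃ q, P p q, fun h => h.choose⟩ : Part (OmegaSeq k))) ↔ P p q := by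
    intro p q
    rw [Part.mem_mk_iff]
    exact ⟨fun ⟨h, e⟩ => e ▸ h.choose_spec,
      fun hq => ⟨⟨q, hq⟩, huniq p _ _ (Exists.choose_spec _) hq⟩⟩
  refine ⟨fun p => ⟨∃ q, P p q, fun h => h.choose⟩, ⟨ψ, hφ'.comp hφ, hψ, hmem⟩, fun p r hr => ?_⟩
  obtain ⟨q, hq, hr⟩ := Part.mem_bind_iff.1 hr
  refine (hmem p r).2 fun n => ?_
  obtain ⟨m, hrm⟩ := (h' q r).1 hr n
  obtain ⟨l, hl⟩ := (h p q).1 hq m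
  exact ⟨l, hrm.trans (hm' _ _ hl)⟩

theorem RepFun.LeSW.trans {f : RepFun k X Y} {g : RepFun k X' Y'} {h : RepFun k X'' Y''}
    (hfg : f.LeSW g) (hgh : g.LeSW h) : f.LeSW h := by
  obtain ⟨G, H, hG, hH, e⟩ := hfg
  obtain ⟨G', H', hG', hH', e'⟩ := hgh
  obtain ⟨GG, hGG, eG⟩ := hG'.comp hG
  obtain ⟨HH, hHH, eH⟩ := hH.comp hH'
  refine ⟨GG, HH, hGG, hHH, fun F hF p x hp => ?_⟩
  obtain ⟨q, hq, hq'⟩ := e _ (e' F hF) p x hp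
  refine ⟨q, ?_, hq'⟩
  obtain ⟨a, ha, hqa⟩ := Part.mem_bind_iff.1 hq
  obtain ⟨b, hb, hab⟩ := Part.mem_bind_iff.1 ha
  obtain ⟨c, hc, hac⟩ := Part.mem_bind_iff.1 hab
  obtain ⟨d, hd, hcd⟩ := Part.mem_bind_iff.1 hc
  exact Part.mem_bind_iff.2 ⟨c, Part.mem_bind_iff.2 ⟨d, eG p d (Part.mem_bind_iff.2 ⟨b, hb, hd⟩),
    hcd⟩, eH c q (Part.mem_bind_iff.2 ⟨a, hac, hqa⟩)⟩

end Reductions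

/-! ### Enumerability of the order on notations of rationals. -/

section Rationals

variable {k : ℕ} {β : Type} [Primcodable β]

/-- The rational number `(m - n) / d`. -/
def fracVal (e : ℕ × ℕ × ℕ) : ℚ := ((e.1 : ℚ) - e.2.1) / e.2.2

/-- The word `u` is of the form `⟨x, y, z⟩` where `x, y, z` are the binary notations of the entries
of `e`, the last of which is not zero. -/
def Denotes (u : Word k) (e : ℕ × ℕ × ℕ) : Prop :=
  ∃ t : Word k × Word k × Word k, (u = tuple [t.1, t.2.1, t.2.2] ∧ nuNat t.1 = some e.1) ∧
    (nuNat t.2.1 = some e.2.1 ∧ nuNat t.2.2 = some e.2.2) ∧ e.2.2 ≠ 0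

theorem nuRat_iff {u : Word k} {a : ℚ} : NuRat u a ↔ ∃ e, Denotes u e ∧ a = fracVal e := by
  constructor
  · rintro ⟨x, y, z, m, n, d, h1, h2, h3, h4, h5, h6⟩
    exact ⟨(m, n, d), ⟨(x, y, z), ⟨h1, h2⟩, ⟨h3, h4⟩, h5⟩, h6⟩
  · rintro ⟨e, ⟨t, ⟨h1, h2⟩, ⟨h3, h4⟩, h5⟩, h6⟩
    exact ⟨_, _, _, _, _, _, h1, h2, h3, h4, h5, h6⟩

theorem Denotes.nuRat {u : Word k} {e : ℕ × ℕ × ℕ} (h : Denotes u e) : NuRat u (fracVal e) :=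
  nuRat_iff.2 ⟨e, h, rfl⟩

theorem Denotes.den_ne {u : Word k} {e : ℕ × ℕ × ℕ} (h : Denotes u e) : e.2.2 ≠ 0 :=
  h.choose_spec.2.2

/-- Only enumerability is needed, so no word has to be parsed: one searches for the three components
and checks that they encode to the given word. -/
theorem CERel.denotes {f : β → Word k} {g : β → ℕ × ℕ × ℕ} (hf : Primrec f) (hg : Primrec g) :
    CERel (k := k) fun b _ _ => Denotes (f b) (g b) := by
  have ht : Primrec fun q : β × Word k × Word k × Word k => q.2 := Primrec.snd
  have ht2 := Primrec.snd.comp ht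
  have hgs := hg.comp (Primrec.fst (α := β) (β := Word k × Word k × Word k))
  have hgs2 := Primrec.snd.comp hgs
  refine CERel.exists (Q := fun (q : β × Word k × Word k × Word k) _ _ =>
    (f q.1 = tuple [q.2.1, q.2.2.1, q.2.2.2] ∧ nuNat q.2.1 = some (g q.1).1) ∧
    (nuNat q.2.2.1 = some (g q.1).2.1 ∧ nuNat q.2.2.2 = some (g q.1).2.2) ∧ (g q.1).2.2 ≠ 0)
    (CERel.of_primrecPred (T := fun q : β × Word k × Word k × Word k =>
    (f q.1 = tuple [q.2.1, q.2.2.1, q.2.2.2] ∧ nuNat q.2.1 = some (g q.1).1) ∧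
    (nuNat q.2.2.1 = some (g q.1).2.1 ∧ nuNat q.2.2.2 = some (g q.1).2.2) ∧ (g q.1).2.2 ≠ 0) ?_)
  refine PrimrecPred.and (PrimrecPred.and ?_ ?_) (PrimrecPred.and (PrimrecPred.and ?_ ?_) ?_)
  · exact Primrec.eq.comp (hf.comp Primrec.fst) (primrec_tuple.comp (Primrec.list_cons.comp
      (Primrec.fst.comp ht) (Primrec.list_cons.comp (Primrec.fst.comp ht2)
        (Primrec.list_cons.comp (Primrec.snd.comp ht2) (Primrec.const [])))))
  · exact Primrec.eq.comp (primrec_nuNat.comp (Primrec.fst.comp ht))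
      (Primrec.option_some.comp (Primrec.fst.comp hgs))
  · exact Primrec.eq.comp (primrec_nuNat.comp (Primrec.fst.comp ht2))
      (Primrec.option_some.comp (Primrec.fst.comp hgs2))
  · exact Primrec.eq.comp (primrec_nuNat.comp (Primrec.snd.comp ht2))
      (Primrec.option_some.comp (Primrec.snd.comp hgs2))
  · exact (Primrec.eq.comp (Primrec.snd.comp hgs2) (Primrec.const 0)).not

/-- Comparison of fractions by cross multiplication. -/
def FracLt (e e' : ℕ × ℕ × ℕ) : Prop :=
  e.1 * e'.2.2 + e'.2.1 * e.2.2 < e'.1 * e.2.2 + e.2.1 * e'.2.2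

theorem fracLt_iff {e e' : ℕ × ℕ × ℕ} (h : e.2.2 ≠ 0) (h' : e'.2.2 ≠ 0) :
    FracLt e e' ↔ fracVal e < fracVal e' := by
  have h1 : (0 : ℚ) < e.2.2 := by exact_mod_cast Nat.pos_of_ne_zero h
  have h2 : (0 : ℚ) < e'.2.2 := by exact_mod_cast Nat.pos_of_ne_zero h'
  rw [fracVal, fracVal, div_lt_div_iff₀ h1 h2, FracLt, ← Nat.cast_lt (α := ℚ)]
  push_cast
  constructor <;> intro h <;> linarith

theorem primrecRel_fracLt : PrimrecRel FracLt := by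
  have h1 : Primrec fun q : (ℕ × ℕ × ℕ) × (ℕ × ℕ × ℕ) => q.1 := Primrec.fst
  have h2 : Primrec fun q : (ℕ × ℕ × ℕ) × (ℕ × ℕ × ℕ) => q.2 := Primrec.snd
  have h11 := Primrec.snd.comp h1
  have h22 := Primrec.snd.comp h2
  exact Primrec.nat_lt.comp
    (Primrec.nat_add.comp (Primrec.nat_mul.comp (Primrec.fst.comp h1) (Primrec.snd.comp h22))
      (Primrec.nat_mul.comp (Primrec.fst.comp h22) (Primrec.snd.comp h11)))
    (Primrec.nat_add.comp (Primrec.nat_mul.comp (Primrec.fst.comp h2) (Primrec.snd.comp h11))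
      (Primrec.nat_mul.comp (Primrec.fst.comp h11) (Primrec.snd.comp h22)))

/-- The rational number denoted by the first word is less than that denoted by the second one. -/
def WordLt (u w : Word k) : Prop :=
  ∃ e : (ℕ × ℕ × ℕ) × ℕ × ℕ × ℕ, Denotes u e.1 ∧ Denotes w e.2 ∧ FracLt e.1 e.2

theorem wordLt_iff {u w : Word k} : WordLt u w ↔ ∃ a b, NuRat u a ∧ NuRat w b ∧ a < b := by
  constructor
  · rintro ⟨e, h1, h2, h3⟩
    exact ⟨_, _, h1.nuRat, h2.nuRat, (fracLt_iff h1.den_ne h2.den_ne).1 h3⟩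
  · rintro ⟨a, b, ha, hb, hab⟩
    obtain ⟨e, he, rfl⟩ := nuRat_iff.1 ha
    obtain ⟨e', he', rfl⟩ := nuRat_iff.1 hb
    exact ⟨(e, e'), he, he', (fracLt_iff he.den_ne he'.den_ne).2 hab⟩

theorem CERel.wordLt {f g : β → Word k} (hf : Primrec f) (hg : Primrec g) :
    CERel (k := k) fun b _ _ => WordLt (f b) (g b) := by
  have h1 : Primrec fun q : β × (ℕ × ℕ × ℕ) × ℕ × ℕ × ℕ => q.2.1 := Primrec.fst.comp Primrec.snd
  have h2 : Primrec fun q : β × (ℕ × ℕ × ℕ) × ℕ × ℕ × ℕ => q.2.2 := Primrec.snd.comp Primrec.snd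
  exact ((CERel.denotes (hf.comp Primrec.fst) h1).and
    ((CERel.denotes (hg.comp Primrec.fst) h2).and
      (CERel.of_primrecPred (primrecRel_fracLt.comp h1 h2)))).exists

/-- The rational number denoted by the word is less than the fraction. -/
def WordLtFrac (u : Word k) (e : ℕ × ℕ × ℕ) : Prop := ∃ e', Denotes u e' ∧ FracLt e' e

/-- The rational number denoted by the word is greater than the fraction. -/
def FracLtWord (e : ℕ × ℕ × ℕ) (u : Word k) : Prop := ∃ e', Denotes u e' ∧ FracLt e e'

theorem wordLtFrac_iff {u : Word k} {e : ℕ × ℕ × ℕ} (he : e.2.2 ≠ 0) :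
    WordLtFrac u e ↔ ∃ a, NuRat u a ∧ a < fracVal e := by
  constructor
  · rintro ⟨e', h1, h2⟩
    exact ⟨_, h1.nuRat, (fracLt_iff h1.den_ne he).1 h2⟩
  · rintro ⟨a, ha, hlt⟩
    obtain ⟨e', he', rfl⟩ := nuRat_iff.1 ha
    exact ⟨e', he', (fracLt_iff he'.den_ne he).2 hlt⟩

theorem fracLtWord_iff {u : Word k} {e : ℕ × ℕ × ℕ} (he : e.2.2 ≠ 0) :
    FracLtWord e u ↔ ∃ a, NuRat u a ∧ fracVal e < a := by
  constructor
  · rintro ⟨e', h1, h2⟩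
    exact ⟨_, h1.nuRat, (fracLt_iff he h1.den_ne).1 h2⟩
  · rintro ⟨a, ha, hlt⟩
    obtain ⟨e', he', rfl⟩ := nuRat_iff.1 ha
    exact ⟨e', he', (fracLt_iff he he'.den_ne).2 hlt⟩

theorem CERel.wordLtFrac {f : β → Word k} {g : β → ℕ × ℕ × ℕ} (hf : Primrec f) (hg : Primrec g) :
    CERel (k := k) fun b _ _ => WordLtFrac (f b) (g b) :=
  ((CERel.denotes (hf.comp Primrec.fst) Primrec.snd).and
    (CERel.of_primrecPred (primrecRel_fracLt.comp Primrec.snd (hg.comp Primrec.fst)))).exists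

theorem CERel.fracLtWord {f : β → Word k} {g : β → ℕ × ℕ × ℕ} (hf : Primrec f) (hg : Primrec g) :
    CERel (k := k) fun b _ _ => FracLtWord (g b) (f b) :=
  ((CERel.denotes (hf.comp Primrec.fst) Primrec.snd).and
    (CERel.of_primrecPred (primrecRel_fracLt.comp (hg.comp Primrec.fst) Primrec.snd))).exists

theorem tuple₂_inj {u v u' v' : Word k} (h : tuple [u, v] = tuple [u', v']) : u = u' ∧ v = v' := by
  simpa using tuple_inj h

theorem tuple₃_inj {u v w u' v' w' : Word k} (h : tuple [u, v, w] = tuple [u', v', w']) :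
    u = u' ∧ v = v' ∧ w = w' := by
  simpa using tuple_inj h

theorem Primrec.tuple₂ {f g : β → Word k} (hf : Primrec f) (hg : Primrec g) :
    Primrec fun b => tuple [f b, g b] :=
  primrec_tuple.comp (Primrec.list_cons.comp hf (Primrec.list_cons.comp hg (Primrec.const [])))

theorem Primrec.tuple₃ {f g h : β → Word k} (hf : Primrec f) (hg : Primrec g) (hh : Primrec h) :
    Primrec fun b => tuple [f b, g b, h b] :=
  primrec_tuple.comp (Primrec.list_cons.comp hf (Primrec.list_cons.comp hg
    (Primrec.list_cons.comp hh (Primrec.const []))))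

end Rationals

/-! ### Positive and negative information from one complementation. -/

section Complement

variable {k : ℕ}

/-- From an enumeration of the complement of a suitable set that can be enumerated from `p`, it is
possible to enumerate the words listed by `p` as well as the words not listed by `p`. -/
theorem exists_maps_of_complement {T : Word k × Word k × Word k → Prop}
    (hT : CERel (k := k) fun b _ _ => T b) :
    ∃ G H : OmegaSeq k → OmegaSeq k, ComputableMap G ∧ ComputableMap H ∧
      ∀ p r, enumerated r = (enumerated (G p))ᶜ →
        listed (H r) = {x | ∃ y ∈ listed p, ∃ z, z ∉ listed p ∧ T (x, y, z)} := by
  -- A left code `(y, n)` enters when `wrap y` does not end at position `n` of `p`, which is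
  -- decidable. A right code `y` enters when `y` is listed. In the complement a left code thus
  -- certifies that `y` is listed, a right code that it is not.
  have hG : CERel fun (i : ℕ) (p _ : OmegaSeq k) =>
      (∃ y : Word k × ℕ, i = Encodable.encode (Sum.inl y : (Word k × ℕ) ⊕ Word k) ∧
        ¬ wrap y.1 <:+ p.pre y.2) ∨
      (∃ y : Word k, i = Encodable.encode (Sum.inr y : (Word k × ℕ) ⊕ Word k) ∧ y ∈ listed p) := by
    refine CERel.or
      (CERel.exists (Q := fun (q : ℕ × Word k × ℕ) (p _ : OmegaSeq k) =>
        q.1 = Encodable.encode (Sum.inl q.2 : (Word k × ℕ) ⊕ Word k) ∧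
          ¬ wrap q.2.1 <:+ p.pre q.2.2) (CERel.and ?_ ?_))
      (CERel.exists (Q := fun (q : ℕ × Word k) (p _ : OmegaSeq k) =>
        q.1 = Encodable.encode (Sum.inr q.2 : (Word k × ℕ) ⊕ Word k) ∧ q.2 ∈ listed p)
        (CERel.and ?_ ?_))
    · exact CERel.of_primrecPred (Primrec.eq.comp Primrec.fst
        (Primrec.encode.comp (Primrec.sumInl.comp Primrec.snd)))
    · refine CERel.of_pre (T := fun (b : ℕ × Word k × ℕ) w => ¬ wrap b.2.1 <:+ w)
        (f := fun b => b.2.2) ?_ (Primrec.snd.comp Primrec.snd)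
      exact PrimrecPred.not (primrecRel_suffix.comp (primrec_wrap.comp
        (Primrec.fst.comp (Primrec.snd.comp Primrec.fst))) Primrec.snd)
    · exact CERel.of_primrecPred (Primrec.eq.comp Primrec.fst
        (Primrec.encode.comp (Primrec.sumInr.comp Primrec.snd)))
    · exact CERel.mem_listed Primrec.snd
  have hH : CERel fun (x : Word k) (r _ : OmegaSeq k) => ∃ t : Word k × ℕ × Word k,
      Encodable.encode (Sum.inl (t.1, t.2.1) : (Word k × ℕ) ⊕ Word k) ∈ enumerated r ∧
      Encodable.encode (Sum.inr t.2.2 : (Word k × ℕ) ⊕ Word k) ∈ enumerated r ∧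
      T (x, t.1, t.2.2) := by
    have h1 : Primrec fun q : Word k × Word k × ℕ × Word k => q.2.1 := Primrec.fst.comp Primrec.snd
    have h2 : Primrec fun q : Word k × Word k × ℕ × Word k => q.2.2 := Primrec.snd.comp Primrec.snd
    have h3 := Primrec.snd.comp h2
    refine CERel.exists (Q := fun (q : Word k × Word k × ℕ × Word k) (r _ : OmegaSeq k) =>
      Encodable.encode (Sum.inl (q.2.1, q.2.2.1) : (Word k × ℕ) ⊕ Word k) ∈ enumerated r ∧
      Encodable.encode (Sum.inr q.2.2.2 : (Word k × ℕ) ⊕ Word k) ∈ enumerated r ∧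
      T (q.1, q.2.1, q.2.2.2)) (CERel.and ?_ (CERel.and ?_ ?_))
    · exact CERel.mem_enumerated (Primrec.encode.comp (Primrec.sumInl.comp
        (h1.pair (Primrec.fst.comp h2))))
    · exact CERel.mem_enumerated (Primrec.encode.comp (Primrec.sumInr.comp h3))
    · exact hT.comp (Primrec.fst.pair (h1.pair h3))
  obtain ⟨G, hGc, hG'⟩ := hG.exists_enumerated
  obtain ⟨H, hHc, hH'⟩ := hH.exists_listed
  refine ⟨G, H, hGc, hHc, fun p r hr => ?_⟩
  rw [hH', hr, hG']
  ext x
  simp only [Set.mem_ofPred_eq, Set.mem_compl_iff]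
  constructor
  · rintro ⟨t, h1, h2, h3⟩
    refine ⟨t.1, ?_, t.2.2, fun h => h2 (Or.inr ⟨_, rfl, h⟩), h3⟩
    by_contra h
    refine h1 (Or.inl ⟨_, rfl, fun hs => h (subword_iff_suffix.2 ⟨_, hs⟩)⟩)
  · rintro ⟨y, hy, z, hz, hT⟩
    obtain ⟨n, hn⟩ := subword_iff_suffix.1 hy
    refine ⟨(y, n, z), ?_, ?_, hT⟩
    · rintro (⟨y', e, h⟩ | ⟨y', e, h⟩)
      · have := Sum.inl_injective (Encodable.encode_injective e)
        exact h (this ▸ hn)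
      · exact absurd (Encodable.encode_injective e) (by simp)
    · rintro (⟨y', e, h⟩ | ⟨y', e, h⟩)
      · exact absurd (Encodable.encode_injective e) (by simp)
      · obtain rfl : z = y' := Sum.inr_injective (Encodable.encode_injective e)
        exact hz h

end Complement

/-! ### The reductions valid for every computable measure. -/

section GeneralReductions

variable {k : ℕ} {Ω : Type*} [MeasurableSpace Ω] {C : CompSigmaAlgebra k Ω} {μ : Measure Ω}

theorem MeasClass.ae_eq {A B : {A : Set Ω // MeasurableSet A}}
    (h : MeasClass.mk μ A = MeasClass.mk μ B) : A.1 =ᵐ[μ] B.1 :=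
  measure_symmDiff_eq_zero_iff.1 (Quotient.exact (s := nullSetoid μ) h)

theorem measureReal_inter_congr {A B : Set Ω} (h : A =ᵐ[μ] B) (R : Set Ω) :
    μ.real (R ∩ A) = μ.real (R ∩ B) :=
  measureReal_congr ((ae_eq_refl R).inter h)

theorem minusWords_congr {A B : Set Ω} (h : A =ᵐ[μ] B) : minusWords C μ A = minusWords C μ B := by
  simp only [minusWords, measureReal_inter_congr h]

theorem plusWords_congr {A B : Set Ω} (h : A =ᵐ[μ] B) : plusWords C μ A = plusWords C μ B := by
  simp only [plusWords, measureReal_inter_congr h]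

theorem tuple_mem_plusWords {A : Set Ω} {u v : Word k} :
    tuple [u, v] ∈ plusWords C μ A ↔
      ∃ a R, NuRat u a ∧ C.alpha v = some R ∧ (a : ℝ) < μ.real (R ∩ A) := by
  constructor
  · rintro ⟨u', v', a, R, e, h⟩
    obtain ⟨rfl, rfl⟩ := tuple₂_inj e
    exact ⟨a, R, h⟩
  · rintro ⟨a, R, h⟩
    exact ⟨u, v, a, R, rfl, h⟩

theorem tuple_mem_minusWords {A : Set Ω} {v w : Word k} :
    tuple [v, w] ∈ minusWords C μ A ↔
      ∃ b R, C.alpha v = some R ∧ NuRat w b ∧ μ.real (R ∩ A) < (b : ℝ) := by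
  constructor
  · rintro ⟨v', w', b, R, e, h⟩
    obtain ⟨rfl, rfl⟩ := tuple₂_inj e
    exact ⟨b, R, h⟩
  · rintro ⟨b, R, h⟩
    exact ⟨v, w, b, R, rfl, h⟩

theorem tuple_mem_zeroWords {A : Set Ω} {u v w : Word k} :
    tuple [u, v, w] ∈ zeroWords C μ A ↔
      ∃ a b R, NuRat u a ∧ C.alpha v = some R ∧ NuRat w b ∧ (a : ℝ) < μ.real (R ∩ A) ∧
        μ.real (R ∩ A) < (b : ℝ) := by
  constructor
  · rintro ⟨u', v', w', a, b, R, e, h⟩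
    obtain ⟨rfl, rfl, rfl⟩ := tuple₃_inj e
    exact ⟨a, b, R, h⟩
  · rintro ⟨a, b, R, h⟩
    exact ⟨u, v, w, a, b, R, rfl, h⟩

theorem zeroWords_eq (A : Set Ω) : zeroWords C μ A = {x | ∃ t : Word k × Word k × Word k,
    x = tuple [t.1, t.2.1, t.2.2] ∧ tuple [t.1, t.2.1] ∈ plusWords C μ A ∧
      tuple [t.2.1, t.2.2] ∈ minusWords C μ A} := by
  ext x
  constructor
  · rintro ⟨u, v, w, a, b, R, rfl, hu, hv, hw, h1, h2⟩
    exact ⟨(u, v, w), rfl, tuple_mem_plusWords.2 ⟨a, R, hu, hv, h1⟩,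
      tuple_mem_minusWords.2 ⟨b, R, hv, hw, h2⟩⟩
  · rintro ⟨t, rfl, h, h'⟩
    obtain ⟨a, R, hu, hv, h1⟩ := tuple_mem_plusWords.1 h
    obtain ⟨b, R', hv', hw, h2⟩ := tuple_mem_minusWords.1 h'
    obtain rfl : R = R' := Option.some_injective _ (hv.symm.trans hv')
    exact tuple_mem_zeroWords.2 ⟨a, b, R, hu, hv, hw, h1, h2⟩

/-- Projecting away the lower bound loses nothing, since some rational lies below `μ(R ∩ A)`.
`plusWords_eq` is the dual fact. -/
theorem minusWords_eq (A : Set Ω) : minusWords C μ A = {x | ∃ t : Word k × Word k × Word k,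
    x = tuple [t.2.1, t.2.2] ∧ tuple [t.1, t.2.1, t.2.2] ∈ zeroWords C μ A} := by
  ext x
  constructor
  · rintro ⟨v, w, b, R, rfl, hv, hw, h⟩
    obtain ⟨a, ha⟩ := exists_rat_lt (μ.real (R ∩ A))
    obtain ⟨u, hu⟩ := NuRat.surj (k := k) a
    exact ⟨(u, v, w), rfl, tuple_mem_zeroWords.2 ⟨a, b, R, hu, hv, hw, ha, h⟩⟩
  · rintro ⟨t, rfl, h⟩
    obtain ⟨a, b, R, hu, hv, hw, h1, h2⟩ := tuple_mem_zeroWords.1 h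
    exact tuple_mem_minusWords.2 ⟨b, R, hv, hw, h2⟩

theorem plusWords_eq (A : Set Ω) : plusWords C μ A = {x | ∃ t : Word k × Word k × Word k,
    x = tuple [t.1, t.2.1] ∧ tuple [t.1, t.2.1, t.2.2] ∈ zeroWords C μ A} := by
  ext x
  constructor
  · rintro ⟨u, v, a, R, rfl, hu, hv, h⟩
    obtain ⟨b, hb⟩ := exists_rat_gt (μ.real (R ∩ A))
    obtain ⟨w, hw⟩ := NuRat.surj (k := k) b
    exact ⟨(u, v, w), rfl, tuple_mem_zeroWords.2 ⟨a, b, R, hu, hv, hw, h, hb⟩⟩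
  · rintro ⟨t, rfl, h⟩
    obtain ⟨a, b, R, hu, hv, hw, h1, h2⟩ := tuple_mem_zeroWords.1 h
    exact tuple_mem_plusWords.2 ⟨a, R, hu, hv, h1⟩

theorem primrec_snd_fst {α β γ : Type} [Primcodable α] [Primcodable β] [Primcodable γ] :
    Primrec fun q : α × β × γ => q.2.1 := Primrec.fst.comp Primrec.snd

theorem primrec_snd_snd {α β γ : Type} [Primcodable α] [Primcodable β] [Primcodable γ] :
    Primrec fun q : α × β × γ => q.2.2 := Primrec.snd.comp Primrec.snd

theorem primrec_snd_snd_fst {α β γ δ : Type} [Primcodable α] [Primcodable β] [Primcodable γ]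
    [Primcodable δ] : Primrec fun q : α × β × γ × δ => q.2.2.1 :=
  Primrec.fst.comp primrec_snd_snd

theorem primrec_snd_snd_snd {α β γ δ : Type} [Primcodable α] [Primcodable β] [Primcodable γ]
    [Primcodable δ] : Primrec fun q : α × β × γ × δ => q.2.2.2 :=
  Primrec.snd.comp primrec_snd_snd

variable (hμ : IsComputableMeasure C μ)

theorem plus_minus_leSW_plus_zero :
    (translation (zetaPlus C μ hμ) (zetaMinus C μ hμ)).LeSW
      (translation (zetaPlus C μ hμ) (zetaZero C μ hμ)) := by
  have h : CERel fun (x : Word k) (r _ : OmegaSeq k) => ∃ t : Word k × Word k × Word k,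
      x = tuple [t.2.1, t.2.2] ∧ tuple [t.1, t.2.1, t.2.2] ∈ listed r :=
    CERel.exists (Q := fun (q : Word k × Word k × Word k × Word k) (r _ : OmegaSeq k) =>
      q.1 = tuple [q.2.2.1, q.2.2.2] ∧ tuple [q.2.1, q.2.2.1, q.2.2.2] ∈ listed r)
      ((CERel.of_primrecPred (Primrec.eq.comp Primrec.fst
        (Primrec.tuple₂ primrec_snd_snd_fst primrec_snd_snd_snd))).and
        (CERel.mem_listed (Primrec.tuple₃ primrec_snd_fst primrec_snd_snd_fst primrec_snd_snd_snd)))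
  obtain ⟨H, hH, e⟩ := h.exists_listed
  refine RepFun.leSW_of_maps computableMap_id hH fun p X hp => ⟨X, hp, ?_⟩
  rintro r ⟨A, hA, hr⟩
  exact ⟨A, hA, by rw [e, hr, minusWords_eq]⟩

theorem minus_plus_leSW_minus_zero :
    (translation (zetaMinus C μ hμ) (zetaPlus C μ hμ)).LeSW
      (translation (zetaMinus C μ hμ) (zetaZero C μ hμ)) := by
  have h : CERel fun (x : Word k) (r _ : OmegaSeq k) => ∃ t : Word k × Word k × Word k,
      x = tuple [t.1, t.2.1] ∧ tuple [t.1, t.2.1, t.2.2] ∈ listed r :=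
    CERel.exists (Q := fun (q : Word k × Word k × Word k × Word k) (r _ : OmegaSeq k) =>
      q.1 = tuple [q.2.1, q.2.2.1] ∧ tuple [q.2.1, q.2.2.1, q.2.2.2] ∈ listed r)
      ((CERel.of_primrecPred (Primrec.eq.comp Primrec.fst
        (Primrec.tuple₂ primrec_snd_fst primrec_snd_snd_fst))).and
        (CERel.mem_listed (Primrec.tuple₃ primrec_snd_fst primrec_snd_snd_fst primrec_snd_snd_snd)))
  obtain ⟨H, hH, e⟩ := h.exists_listed
  refine RepFun.leSW_of_maps computableMap_id hH fun p X hp => ⟨X, hp, ?_⟩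
  rintro r ⟨A, hA, hr⟩
  exact ⟨A, hA, by rw [e, hr, plusWords_eq]⟩

theorem ceRel_zeroWords : CERel fun (x : Word k) (p r : OmegaSeq k) =>
    ∃ t : Word k × Word k × Word k, x = tuple [t.1, t.2.1, t.2.2] ∧
      tuple [t.1, t.2.1] ∈ listed p ∧ tuple [t.2.1, t.2.2] ∈ listed r :=
  CERel.exists (Q := fun (q : Word k × Word k × Word k × Word k) (p r : OmegaSeq k) =>
    q.1 = tuple [q.2.1, q.2.2.1, q.2.2.2] ∧ tuple [q.2.1, q.2.2.1] ∈ listed p ∧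
      tuple [q.2.2.1, q.2.2.2] ∈ listed r)
    ((CERel.of_primrecPred (Primrec.eq.comp Primrec.fst
      (Primrec.tuple₃ primrec_snd_fst primrec_snd_snd_fst primrec_snd_snd_snd))).and
      ((CERel.mem_listed (Primrec.tuple₂ primrec_snd_fst primrec_snd_snd_fst)).and
        (CERel.mem_listed (Primrec.tuple₂ primrec_snd_snd_fst primrec_snd_snd_snd)).swap))

theorem plus_zero_leW_plus_minus :
    (translation (zetaPlus C μ hμ) (zetaZero C μ hμ)).LeW
      (translation (zetaPlus C μ hμ) (zetaMinus C μ hμ)) := by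
  obtain ⟨H, hH, e⟩ := (ceRel_zeroWords (k := k)).exists_listed₂
  refine RepFun.leW_of_maps computableMap_id hH ?_
  rintro p X ⟨A, rfl, hp⟩
  refine ⟨_, ⟨A, rfl, hp⟩, ?_⟩
  rintro r ⟨B, hB, hr⟩
  refine ⟨A, rfl, ?_⟩
  rw [e, hp, hr, ← minusWords_congr (MeasClass.ae_eq hB), zeroWords_eq]

theorem minus_zero_leW_minus_plus :
    (translation (zetaMinus C μ hμ) (zetaZero C μ hμ)).LeW
      (translation (zetaMinus C μ hμ) (zetaPlus C μ hμ)) := by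
  obtain ⟨H, hH, e⟩ := (ceRel_zeroWords (k := k)).swap.exists_listed₂
  refine RepFun.leW_of_maps computableMap_id hH ?_
  rintro p X ⟨A, rfl, hp⟩
  refine ⟨_, ⟨A, rfl, hp⟩, ?_⟩
  rintro r ⟨B, hB, hr⟩
  refine ⟨A, rfl, ?_⟩
  rw [e, hp, hr, ← plusWords_congr (MeasClass.ae_eq hB), zeroWords_eq]

/-- `⟨u, v, w⟩` is produced from a listed `⟨u, v⟩` and an unlisted `⟨w', v⟩` with `w' < w`. The
listed word guarantees that `v` is in the domain of `α` and the comparison that `w'` denotes a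
rational; being unlisted then really means `μ(α(v) ∩ A) ≤ w'`. -/
theorem plus_zero_leSW_CE :
    (translation (zetaPlus C μ hμ) (zetaZero C μ hμ)).LeSW (CE k) := by
  have hT : CERel (k := k) fun (b : Word k × Word k × Word k) _ _ =>
      ∃ t : (Word k × Word k) × Word k × Word k, b.1 = tuple [t.1.1, t.1.2, t.2.1] ∧
        b.2.1 = tuple [t.1.1, t.1.2] ∧ b.2.2 = tuple [t.2.2, t.1.2] ∧ WordLt t.2.2 t.2.1 := by
    have h1 : Primrec fun q : (Word k × Word k × Word k) × (Word k × Word k) × Word k × Word k =>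
      q.2.1.1 := Primrec.fst.comp primrec_snd_fst
    have h2 : Primrec fun q : (Word k × Word k × Word k) × (Word k × Word k) × Word k × Word k =>
      q.2.1.2 := Primrec.snd.comp primrec_snd_fst
    exact CERel.exists
      (Q := fun (q : (Word k × Word k × Word k) × (Word k × Word k) × Word k × Word k) _ _ =>
        q.1.1 = tuple [q.2.1.1, q.2.1.2, q.2.2.1] ∧ q.1.2.1 = tuple [q.2.1.1, q.2.1.2] ∧
          q.1.2.2 = tuple [q.2.2.2, q.2.1.2] ∧ WordLt q.2.2.2 q.2.2.1)
      ((CERel.of_primrecPred (Primrec.eq.comp (Primrec.fst.comp Primrec.fst)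
        (Primrec.tuple₃ h1 h2 primrec_snd_snd_fst))).and
        ((CERel.of_primrecPred (Primrec.eq.comp (primrec_snd_fst.comp Primrec.fst)
          (Primrec.tuple₂ h1 h2))).and
          ((CERel.of_primrecPred (Primrec.eq.comp (primrec_snd_snd.comp Primrec.fst)
            (Primrec.tuple₂ primrec_snd_snd_snd h2))).and
            (CERel.wordLt primrec_snd_snd_snd primrec_snd_snd_fst))))
  obtain ⟨G, H, hG, hH, e⟩ := exists_maps_of_complement hT
  refine RepFun.leSW_of_maps hG hH ?_
  rintro p X ⟨A, rfl, hp⟩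
  refine ⟨_, rfl, fun r hr => ⟨A, rfl, ?_⟩⟩
  rw [e p r hr, hp]
  ext x
  constructor
  · rintro ⟨y, hy, z, hz, ⟨⟨u, v⟩, w, w'⟩, rfl, rfl, rfl, hlt⟩
    obtain ⟨a, R, hu, hv, h1⟩ := tuple_mem_plusWords.1 hy
    obtain ⟨b', b, hw', hw, hb⟩ := wordLt_iff.1 hlt
    refine tuple_mem_zeroWords.2 ⟨a, b, R, hu, hv, hw, h1, ?_⟩
    have : μ.real (R ∩ A.1) ≤ b' := by
      by_contra hc
      exact hz (tuple_mem_plusWords.2 ⟨b', R, hw', hv, not_le.1 hc⟩)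
    exact this.trans_lt (by exact_mod_cast hb)
  · rintro ⟨u, v, w, a, b, R, rfl, hu, hv, hw, h1, h2⟩
    -- Density supplies a rational between the measure and the upper bound, which is not a strict
    -- lower bound.
    obtain ⟨b', hb', hb⟩ := exists_rat_btwn h2
    obtain ⟨w', hw'⟩ := NuRat.surj (k := k) b'
    refine ⟨_, tuple_mem_plusWords.2 ⟨a, R, hu, hv, h1⟩, tuple [w', v], fun hz => ?_,
      ⟨(u, v), w, w'⟩, rfl, rfl, rfl, wordLt_iff.2 ⟨b', b, hw', hw, by exact_mod_cast hb⟩⟩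
    obtain ⟨c, R', hc, hR', hlt⟩ := tuple_mem_plusWords.1 hz
    obtain rfl : R = R' := Option.some_injective _ (hv.symm.trans hR')
    obtain rfl := hw'.unique hc
    exact lt_asymm hlt hb'

/-- Dual argument: an unlisted `⟨v, u'⟩` with `u < u'` certifies `u < u' ≤ μ(α(v) ∩ A)`. -/
theorem minus_zero_leSW_CE :
    (translation (zetaMinus C μ hμ) (zetaZero C μ hμ)).LeSW (CE k) := by
  have hT : CERel (k := k) fun (b : Word k × Word k × Word k) _ _ =>
      ∃ t : (Word k × Word k) × Word k × Word k, b.1 = tuple [t.2.1, t.1.1, t.1.2] ∧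
        b.2.1 = tuple [t.1.1, t.1.2] ∧ b.2.2 = tuple [t.1.1, t.2.2] ∧ WordLt t.2.1 t.2.2 := by
    have h1 : Primrec fun q : (Word k × Word k × Word k) × (Word k × Word k) × Word k × Word k =>
      q.2.1.1 := Primrec.fst.comp primrec_snd_fst
    have h2 : Primrec fun q : (Word k × Word k × Word k) × (Word k × Word k) × Word k × Word k =>
      q.2.1.2 := Primrec.snd.comp primrec_snd_fst
    exact CERel.exists
      (Q := fun (q : (Word k × Word k × Word k) × (Word k × Word k) × Word k × Word k) _ _ =>
        q.1.1 = tuple [q.2.2.1, q.2.1.1, q.2.1.2] ∧ q.1.2.1 = tuple [q.2.1.1, q.2.1.2] ∧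
          q.1.2.2 = tuple [q.2.1.1, q.2.2.2] ∧ WordLt q.2.2.1 q.2.2.2)
      ((CERel.of_primrecPred (Primrec.eq.comp (Primrec.fst.comp Primrec.fst)
        (Primrec.tuple₃ primrec_snd_snd_fst h1 h2))).and
        ((CERel.of_primrecPred (Primrec.eq.comp (primrec_snd_fst.comp Primrec.fst)
          (Primrec.tuple₂ h1 h2))).and
          ((CERel.of_primrecPred (Primrec.eq.comp (primrec_snd_snd.comp Primrec.fst)
            (Primrec.tuple₂ h1 primrec_snd_snd_snd))).and
            (CERel.wordLt primrec_snd_snd_fst primrec_snd_snd_snd))))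
  obtain ⟨G, H, hG, hH, e⟩ := exists_maps_of_complement hT
  refine RepFun.leSW_of_maps hG hH ?_
  rintro p X ⟨A, rfl, hp⟩
  refine ⟨_, rfl, fun r hr => ⟨A, rfl, ?_⟩⟩
  rw [e p r hr, hp]
  ext x
  constructor
  · rintro ⟨y, hy, z, hz, ⟨⟨v, w⟩, u, u'⟩, rfl, rfl, rfl, hlt⟩
    obtain ⟨b, R, hv, hw, h1⟩ := tuple_mem_minusWords.1 hy
    obtain ⟨a, a', hu, hu', ha⟩ := wordLt_iff.1 hlt
    refine tuple_mem_zeroWords.2 ⟨a, b, R, hu, hv, hw, ?_, h1⟩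
    have : (a' : ℝ) ≤ μ.real (R ∩ A.1) := by
      by_contra hc
      exact hz (tuple_mem_minusWords.2 ⟨a', R, hv, hu', not_le.1 hc⟩)
    exact lt_of_lt_of_le (by exact_mod_cast ha) this
  · rintro ⟨u, v, w, a, b, R, rfl, hu, hv, hw, h1, h2⟩
    obtain ⟨a', ha, ha'⟩ := exists_rat_btwn h1
    obtain ⟨u', hu'⟩ := NuRat.surj (k := k) a'
    refine ⟨_, tuple_mem_minusWords.2 ⟨b, R, hv, hw, h2⟩, tuple [v, u'], fun hz => ?_,
      ⟨(v, w), u, u'⟩, rfl, rfl, rfl, wordLt_iff.2 ⟨a, a', hu, hu', by exact_mod_cast ha⟩⟩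
    obtain ⟨c, R', hR', hc, hlt⟩ := tuple_mem_minusWords.1 hz
    obtain rfl : R = R' := Option.some_injective _ (hv.symm.trans hR')
    obtain rfl := hu'.unique hc
    exact lt_asymm hlt ha'

end GeneralReductions

/-! ### Finite sets of naturals denoted by characteristic words. -/

section Bitmaps

variable {k : ℕ}

/-- The finite set whose characteristic word is `v`. -/
def bits (v : Word k) : Set ℕ := {i | v[i]? = some 1}

theorem mem_bits {v : Word k} {i : ℕ} : i ∈ bits v ↔ v[i]? = some 1 := Iff.rfl

theorem lt_length_of_mem_bits {v : Word k} {i : ℕ} (h : i ∈ bits v) : i < v.length := by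
  by_contra hc
  rw [mem_bits, List.getElem?_eq_none (not_lt.1 hc)] at h
  simp at h

theorem finite_bits (v : Word k) : (bits v).Finite :=
  (Set.finite_lt_nat v.length).subset fun _ h => lt_length_of_mem_bits h

theorem exists_bits_eq {F : Set ℕ} (hF : F.Finite) : ∃ v : Word k, bits v = F := by
  classical
  obtain ⟨N, hN⟩ := hF.bddAbove
  refine ⟨(List.range (N + 1)).map fun i => if i ∈ F then 1 else 0, Set.ext fun i => ?_⟩
  rw [mem_bits, List.getElem?_map]
  rcases Nat.lt_or_ge i (N + 1) with h | h
  · by_cases hi : i ∈ F <;> simp [h, hi]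
  · have : i ∉ F := fun hi => absurd (hN hi) (by omega)
    rw [List.getElem?_eq_none (by simpa using h)]
    simp [this]

theorem range_bits : {R | ∃ v : Word k, bits v = R} = {R | R.Finite} :=
  Set.ext fun _ => ⟨fun ⟨v, h⟩ => h ▸ finite_bits v, exists_bits_eq⟩

/-- Boolean combination of characteristic words. -/
def mergeBits (f : Bool → Bool → Bool) (u v : Word k) : Word k :=
  (List.range (u.length + v.length)).map fun i =>
    bif f (decide (u[i]? = some 1)) (decide (v[i]? = some 1)) then 1 else 0

/-- The merged word is at least as long as both arguments. Positions beyond its end belong to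
neither set, which is where `f false false = false` enters. -/
theorem mem_bits_mergeBits {f : Bool → Bool → Bool} (hf : f false false = false) {u v : Word k}
    {i : ℕ} : i ∈ bits (mergeBits f u v) ↔
      f (decide (u[i]? = some 1)) (decide (v[i]? = some 1)) = true := by
  rw [mem_bits, mergeBits, List.getElem?_map]
  rcases Nat.lt_or_ge i (u.length + v.length) with h | h
  · rw [List.getElem?_range h]
    cases h : f (decide (u[i]? = some 1)) (decide (v[i]? = some 1)) <;> simp [h]
  · rw [List.getElem?_eq_none (l := u) (by omega), List.getElem?_eq_none (l := v) (by omega)]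
    simp [h, hf]

theorem bits_union (u v : Word k) : bits (mergeBits (· || ·) u v) = bits u ∪ bits v := by
  ext i; rw [mem_bits_mergeBits rfl]; simp [mem_bits]

theorem bits_inter (u v : Word k) : bits (mergeBits (· && ·) u v) = bits u ∩ bits v := by
  ext i; rw [mem_bits_mergeBits rfl]; simp [mem_bits]

theorem bits_diff (u v : Word k) : bits (mergeBits (fun a b => a && !b) u v) = bits u \ bits v := by
  ext i; rw [mem_bits_mergeBits rfl]; simp [mem_bits]

theorem primrec_mergeBits (f : Bool → Bool → Bool) :
    Primrec₂ (mergeBits f : Word k → Word k → Word k) := by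
  have h1 : Primrec fun q : (Word k × Word k) × ℕ => decide (q.1.1[q.2]? = some 1) :=
    (Primrec.eq.comp (Primrec.list_getElem?.comp (Primrec.fst.comp Primrec.fst) Primrec.snd)
      (Primrec.const _)).decide
  have h2 : Primrec fun q : (Word k × Word k) × ℕ => decide (q.1.2[q.2]? = some 1) :=
    (Primrec.eq.comp (Primrec.list_getElem?.comp (Primrec.snd.comp Primrec.fst) Primrec.snd)
      (Primrec.const _)).decide
  exact Primrec.list_map (Primrec.list_range.comp (Primrec.nat_add.comp
    (Primrec.list_length.comp Primrec.fst) (Primrec.list_length.comp Primrec.snd)))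
    (Primrec.cond ((Primrec.dom_bool₂ f).comp h1 h2) (Primrec.const _) (Primrec.const _)).to₂

/-- The characteristic word of `{i}`. -/
def singleBit (i : ℕ) : Word k := (List.range i).map (fun _ => 0) ++ [1]

theorem bits_singleBit (i : ℕ) : bits (singleBit i : Word k) = {i} := by
  ext j
  rw [mem_bits, singleBit, Set.mem_singleton_iff, List.getElem?_append]
  split_ifs with h
  · rw [List.length_map, List.length_range] at h
    simp [h, h.ne]
  · rw [List.length_map, List.length_range] at *
    rcases eq_or_ne j i with rfl | hne
    · simp
    · have : 0 < j - i := by omega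
      rw [List.getElem?_eq_none (by simp; omega)]
      simp [hne]

theorem primrec_singleBit : Primrec (singleBit : ℕ → Word k) :=
  Primrec.list_append.comp (Primrec.list_map Primrec.list_range (Primrec.const (0 : Symb k)).to₂)
    (Primrec.const _)

theorem isSetRing_finite {α : Type*} : IsSetRing {R : Set α | R.Finite} where
  empty_mem := Set.finite_empty
  union_mem _ _ h h' := Set.Finite.union h h'
  sdiff_mem _ _ h _ := Set.Finite.sdiff h

/-- The ring of the finite subsets of `ℕ`, denoted by their characteristic words. -/
def finiteSigmaAlgebra (k : ℕ) : CompSigmaAlgebra k ℕ where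
  alpha v := some (bits v)
  isSetRing := by
    simp only [Option.some.injEq, range_bits]
    exact isSetRing_finite
  sUnion_ring := by
    simp only [Option.some.injEq, range_bits]
    exact Set.eq_univ_of_forall fun i => ⟨{i}, Set.finite_singleton i, rfl⟩
  generates := by
    simp only [Option.some.injEq, range_bits]
    refine le_antisymm (fun A _ => ?_) le_top
    rw [← Set.biUnion_of_singleton A]
    exact MeasurableSet.biUnion A.to_countable fun i _ =>
      MeasurableSpace.measurableSet_generateFrom (Set.finite_singleton i)
  dom_recursive := by
    refine (Computable.computablePred (p := fun _ : Word k => True) ?_).of_eq fun v => by simp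
    simpa using Computable.const true
  union_computable := by
    refine ⟨fun u v => Part.some (mergeBits (· || ·) u v),
      (primrec_mergeBits _).to_comp.partrec₂, ?_⟩
    rintro u v _ _ ⟨⟩ ⟨⟩
    exact ⟨_, Part.mem_some _, congrArg some (bits_union u v)⟩
  diff_computable := by
    refine ⟨fun u v => Part.some (mergeBits (fun a b => a && !b) u v),
      (primrec_mergeBits _).to_comp.partrec₂, ?_⟩
    rintro u v _ _ ⟨⟩ ⟨⟩
    exact ⟨_, Part.mem_some _, congrArg some (bits_diff u v)⟩

theorem finiteSigmaAlgebra_ring : (finiteSigmaAlgebra k).ring = {R | R.Finite} := by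
  simp only [CompSigmaAlgebra.ring, finiteSigmaAlgebra, Option.some.injEq, range_bits]

/-- The numerator and the denominator of `2/3 * ∑ i ∈ bits v, 3⁻ⁱ`. -/
def ternaryFrac (v : Word k) : ℕ × ℕ × ℕ :=
  (v.foldl (fun n a => 3 * n + if a = 1 then 2 else 0) 0, 0, 3 ^ v.length)

theorem primrec_ternaryFrac : Primrec (ternaryFrac : Word k → ℕ × ℕ × ℕ) := by
  have h1 : Primrec fun v : Word k => v.foldl (fun n a => 3 * n + if a = 1 then 2 else 0) 0 := by
    refine Primrec.list_foldl
      (h := fun _ (x : ℕ × Symb k) => 3 * x.1 + if x.2 = 1 then 2 else 0)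
      Primrec.id (Primrec.const 0) ?_
    exact (Primrec.nat_add.comp (Primrec.nat_mul.comp (Primrec.const 3) primrec_snd_fst)
      (Primrec.ite (Primrec.eq.comp primrec_snd_snd (Primrec.const _)) (Primrec.const _)
        (Primrec.const _))).to₂
  exact h1.pair ((Primrec.const 0).pair ((primrec_const_pow 3).comp Primrec.list_length))

theorem ternaryFrac_den_ne (v : Word k) : (ternaryFrac v).2.2 ≠ 0 := by simp [ternaryFrac]

end Bitmaps

/-! ### The measure with weights `2/3 * 3⁻ⁱ` and its computability. -/

section GeometricMeasure

variable {k : ℕ}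

/-- The probability measure on `ℕ` with weights `2/3 * 3⁻ⁱ`. -/
noncomputable def ternaryMeasure : Measure ℕ :=
  Measure.sum fun i => ENNReal.ofReal (2 / 3 * (1 / 3) ^ i) • Measure.dirac i

theorem ternaryMeasure_apply (A : Set ℕ) :
    ternaryMeasure A = ∑' i : A, ENNReal.ofReal (2 / 3 * (1 / 3) ^ (i : ℕ)) := by
  rw [ternaryMeasure, Measure.sum_apply _ MeasurableSet.of_discrete,
    tsum_subtype A fun i => ENNReal.ofReal (2 / 3 * (1 / 3) ^ i)]
  refine tsum_congr fun i => ?_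
  by_cases h : i ∈ A <;> simp [h]

instance : IsProbabilityMeasure ternaryMeasure := by
  refine ⟨?_⟩
  rw [ternaryMeasure_apply, tsum_univ fun i : ℕ => ENNReal.ofReal (2 / 3 * (1 / 3) ^ i),
    ← ENNReal.ofReal_tsum_of_nonneg (fun i => by positivity)
      ((summable_geometric_of_lt_one (by norm_num) (by norm_num)).mul_left _),
    tsum_mul_left, tsum_geometric_of_lt_one (by norm_num) (by norm_num)]
  norm_num

theorem ternaryMeasure_real_singleton (i : ℕ) :
    ternaryMeasure.real {i} = 2 / 3 * (1 / 3) ^ i := by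
  rw [Measure.real, ternaryMeasure_apply,
    tsum_singleton i fun i => ENNReal.ofReal (2 / 3 * (1 / 3) ^ i),
    ENNReal.toReal_ofReal (by positivity)]

theorem bits_concat (v : Word k) (a : Symb k) :
    bits (v ++ [a]) = bits v ∪ if a = 1 then {v.length} else ∅ := by
  ext i
  rw [Set.mem_union, mem_bits, mem_bits]
  rcases lt_trichotomy i v.length with h | rfl | h
  · rw [List.getElem?_append_left h]
    split_ifs <;> simp [h.ne]
  · split_ifs with ha <;> simp [ha]
  · rw [List.getElem?_eq_none (by simp; omega), List.getElem?_eq_none (by omega)]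
    split_ifs <;> simp [h.ne']

/-- This is Horner's scheme in base 3 with digits 0 and 2. Appending a symbol triples numerator and
denominator, and a final `1` adds `2 / 3 ^ (v.length + 1)`, the weight of the point `v.length`. -/
theorem ternaryMeasure_real_bits (v : Word k) :
    ternaryMeasure.real (bits v) = (fracVal (ternaryFrac v) : ℚ) := by
  induction v using List.reverseRecOn with
  | nil => simp [bits, fracVal, ternaryFrac]
  | append_singleton v a ih =>
    rw [bits_concat, measureReal_union _ MeasurableSet.of_discrete, ih]
    · have h3 : (3 : ℝ) ^ v.length ≠ 0 := by positivity
      split_ifs with ha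
      · rw [ternaryMeasure_real_singleton]
        simp only [fracVal, ternaryFrac, List.foldl_append, List.foldl_cons, List.foldl_nil, ha,
          if_true, List.length_append, List.length_cons, List.length_nil]
        push_cast
        rw [one_div, inv_pow]
        field_simp
        ring
      · simp only [fracVal, ternaryFrac, List.foldl_append, List.foldl_cons, List.foldl_nil, ha,
          if_false, List.length_append, List.length_cons, List.length_nil]
        push_cast
        rw [measureReal_empty]
        field_simp
        ring
    · split_ifs
      · refine Set.disjoint_singleton_right.2 fun h => absurd (lt_length_of_mem_bits h) (by omega)
      · exact Set.disjoint_empty _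

theorem wordLtFrac_ternaryFrac_iff {u v : Word k} :
    WordLtFrac u (ternaryFrac v) ↔ ∃ a, NuRat u a ∧ (a : ℝ) < ternaryMeasure.real (bits v) := by
  rw [wordLtFrac_iff (ternaryFrac_den_ne v), ternaryMeasure_real_bits]
  simp only [Rat.cast_lt]

theorem fracLtWord_ternaryFrac_iff {u v : Word k} :
    FracLtWord (ternaryFrac v) u ↔ ∃ a, NuRat u a ∧ ternaryMeasure.real (bits v) < (a : ℝ) := by
  rw [fracLtWord_iff (ternaryFrac_den_ne v), ternaryMeasure_real_bits]
  simp only [Rat.cast_lt]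

theorem isComputableMeasure_ternaryMeasure :
    IsComputableMeasure (finiteSigmaAlgebra k) ternaryMeasure := by
  refine ⟨fun R _ => measure_lt_top _ R, ?_⟩
  obtain ⟨r, hr, er⟩ := CERel.exists_primrec_listed (k := k)
    (Q := fun q : Word k × Word k => WordLtFrac q.1 (ternaryFrac q.2))
    (CERel.wordLtFrac Primrec.fst (primrec_ternaryFrac.comp Primrec.snd))
  obtain ⟨s, hs, es⟩ := CERel.exists_primrec_listed (k := k)
    (Q := fun q : Word k × Word k => FracLtWord (ternaryFrac q.2) q.1)
    (CERel.fracLtWord Primrec.fst (primrec_ternaryFrac.comp Primrec.snd))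
  have hhalf : Primrec fun q : Word k × ℕ => q.2 / 2 :=
    Primrec.nat_div.comp Primrec.snd (Primrec.const 2)
  -- A `ρ`-name interleaves the list of lower bounds (even positions) with that of upper bounds (odd
  -- positions).
  have hg : Primrec₂ fun (v : Word k) (n : ℕ) => if n % 2 = 0 then r v (n / 2) else s v (n / 2) :=
    Primrec.ite (Primrec.eq.comp (Primrec.nat_mod.comp Primrec.snd (Primrec.const 2))
      (Primrec.const 0)) (hr.comp Primrec.fst hhalf) (hs.comp Primrec.fst hhalf)
  refine ⟨fun v n => Part.some (if n % 2 = 0 then r v (n / 2) else s v (n / 2)),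
    hg.to_comp.partrec₂, ?_⟩
  rintro v _ ⟨⟩
  refine ⟨_, fun n => Part.mem_some _, ?_, ?_⟩
  · have : (fun n => if 2 * n % 2 = 0 then r v (2 * n / 2) else s v (2 * n / 2)) = r v := by
      funext n; simp
    rw [RhoLower, this, er]
    exact Set.ext fun u => wordLtFrac_ternaryFrac_iff
  · have : (fun n => if (2 * n + 1) % 2 = 0 then r v ((2 * n + 1) / 2)
        else s v ((2 * n + 1) / 2)) = s v := by
      funext n
      rw [if_neg (by omega), show (2 * n + 1) / 2 = n by omega]
    rw [RhoUpper, this, es]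
    exact Set.ext fun u => fracLtWord_ternaryFrac_iff

end GeometricMeasure

/-! ### Reducing complementation to the translations. -/

section Completeness

variable {k : ℕ} {β : Type} [Primcodable β]

theorem CERel.bits_subset_enumerated {f : β → Word k} (hf : Primrec f) :
    CERel fun b (p _ : OmegaSeq k) => bits (f b) ⊆ enumerated p := by
  have h : CERel fun (q : β × ℕ) (p _ : OmegaSeq k) =>
      ¬ (f q.1)[q.2]? = some 1 ∨ q.2 ∈ enumerated p :=
    (CERel.of_primrecPred (Primrec.eq.comp (Primrec.list_getElem?.comp (hf.comp Primrec.fst)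
      Primrec.snd) (Primrec.const (some 1))).not).or (CERel.mem_enumerated Primrec.snd)
  refine (h.forall_lt (Primrec.list_length.comp hf)).of_iff fun b p _ => ?_
  constructor
  · intro hb i _
    exact or_iff_not_imp_left.2 fun hi => hb (not_not.1 hi)
  · intro hb i hi
    exact (hb i (lt_length_of_mem_bits hi)).resolve_left fun hn => hn hi

theorem mem_plusWords_ternary {A : Set ℕ} {u v : Word k} :
    tuple [u, v] ∈ plusWords (finiteSigmaAlgebra k) ternaryMeasure A ↔
      ∃ a, NuRat u a ∧ (a : ℝ) < ternaryMeasure.real (bits v ∩ A) := by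
  rw [tuple_mem_plusWords]
  simp [finiteSigmaAlgebra]

theorem mem_minusWords_ternary {A : Set ℕ} {v w : Word k} :
    tuple [v, w] ∈ minusWords (finiteSigmaAlgebra k) ternaryMeasure A ↔
      ∃ b, NuRat w b ∧ ternaryMeasure.real (bits v ∩ A) < (b : ℝ) := by
  rw [tuple_mem_minusWords]
  simp [finiteSigmaAlgebra]

/-- `R ∩ K` is itself finite for finite `R`, so the supremum of `μ(R ∩ F)` over finite `F ⊆ K` is
attained. Every strict lower bound is therefore witnessed by some finite `F`, and by monotonicity no
other bound is. -/
theorem plusWords_enumerated (p : OmegaSeq k) :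
    plusWords (finiteSigmaAlgebra k) ternaryMeasure (enumerated p) =
      {x | ∃ t : Word k × Word k × Word k, x = tuple [t.1, t.2.1] ∧
        bits t.2.2 ⊆ enumerated p ∧
        WordLtFrac t.1 (ternaryFrac (mergeBits (· && ·) t.2.1 t.2.2))} := by
  ext x
  constructor
  · rintro ⟨u, v, a, R, rfl, hu, hv, h⟩
    obtain ⟨v', hv'⟩ := exists_bits_eq (k := k) ((finite_bits v).inter_of_left (enumerated p))
    refine ⟨(u, v, v'), rfl, ?_, ?_⟩
    · dsimp only; rw [hv']; exact Set.inter_subset_right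
    · rw [wordLtFrac_ternaryFrac_iff, bits_inter, hv', ← Set.inter_assoc, Set.inter_self]
      exact mem_plusWords_ternary.1 (tuple_mem_plusWords.2 ⟨a, R, hu, hv, h⟩)
  · rintro ⟨⟨u, v, v'⟩, rfl, hsub, hlt⟩
    obtain ⟨a, ha, hlt⟩ := wordLtFrac_ternaryFrac_iff.1 hlt
    rw [bits_inter] at hlt
    exact mem_plusWords_ternary.2 ⟨a, ha, hlt.trans_le
      (measureReal_mono (Set.inter_subset_inter_right _ hsub))⟩

/-- Removing a finite `F ⊆ K` from `R` bounds `μ(R \ K)` from above, with equality for `F = R ∩ K`.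
-/
theorem minusWords_compl_enumerated (p : OmegaSeq k) :
    minusWords (finiteSigmaAlgebra k) ternaryMeasure (enumerated p)ᶜ =
      {x | ∃ t : Word k × Word k × Word k, x = tuple [t.1, t.2.1] ∧
        bits t.2.2 ⊆ enumerated p ∧
        FracLtWord (ternaryFrac (mergeBits (fun a b => a && !b) t.1 t.2.2)) t.2.1} := by
  ext x
  constructor
  · rintro ⟨v, w, b, R, rfl, hv, hw, h⟩
    obtain ⟨v', hv'⟩ := exists_bits_eq (k := k) ((finite_bits v).inter_of_left (enumerated p))
    refine ⟨(v, w, v'), rfl, ?_, ?_⟩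
    · dsimp only; rw [hv']; exact Set.inter_subset_right
    · rw [fracLtWord_ternaryFrac_iff, bits_diff, hv', Set.sdiff_self_inter, Set.sdiff_eq]
      exact mem_minusWords_ternary.1 (tuple_mem_minusWords.2 ⟨b, R, hv, hw, h⟩)
  · rintro ⟨⟨v, w, v'⟩, rfl, hsub, hlt⟩
    obtain ⟨b, hb, hlt⟩ := fracLtWord_ternaryFrac_iff.1 hlt
    rw [bits_diff] at hlt
    refine mem_minusWords_ternary.2 ⟨b, hb, lt_of_le_of_lt (measureReal_mono ?_) hlt⟩
    exact fun i hi => ⟨hi.1, fun h => hi.2 (hsub h)⟩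

/-- The enumerated set `K` is passed on as it stands. Each point has positive weight, so `i ∉ K` iff
a rational upper bound for `μ({i} ∩ K)` appears below `μ({i})`. -/
theorem CE_leSW_plus_minus :
    (CE k).LeSW (translation
      (zetaPlus (finiteSigmaAlgebra k) ternaryMeasure isComputableMeasure_ternaryMeasure)
      (zetaMinus (finiteSigmaAlgebra k) ternaryMeasure isComputableMeasure_ternaryMeasure)) := by
  have hG : CERel fun (x : Word k) (p _ : OmegaSeq k) => ∃ t : Word k × Word k × Word k,
      x = tuple [t.1, t.2.1] ∧ bits t.2.2 ⊆ enumerated p ∧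
        WordLtFrac t.1 (ternaryFrac (mergeBits (· && ·) t.2.1 t.2.2)) :=
    CERel.exists (Q := fun (q : Word k × Word k × Word k × Word k) (p _ : OmegaSeq k) =>
      q.1 = tuple [q.2.1, q.2.2.1] ∧ bits q.2.2.2 ⊆ enumerated p ∧
        WordLtFrac q.2.1 (ternaryFrac (mergeBits (· && ·) q.2.2.1 q.2.2.2)))
      ((CERel.of_primrecPred (Primrec.eq.comp Primrec.fst
        (Primrec.tuple₂ primrec_snd_fst primrec_snd_snd_fst))).and
        ((CERel.bits_subset_enumerated primrec_snd_snd_snd).and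
          (CERel.wordLtFrac primrec_snd_fst (primrec_ternaryFrac.comp
            ((primrec_mergeBits _).comp primrec_snd_snd_fst primrec_snd_snd_snd)))))
  have hH : CERel fun (i : ℕ) (r _ : OmegaSeq k) => ∃ w : Word k,
      tuple [singleBit i, w] ∈ listed r ∧ WordLtFrac w (ternaryFrac (singleBit i : Word k)) :=
    CERel.exists (Q := fun (q : ℕ × Word k) (r _ : OmegaSeq k) =>
      tuple [singleBit q.1, q.2] ∈ listed r ∧ WordLtFrac q.2 (ternaryFrac (singleBit q.1 : Word k)))
      ((CERel.mem_listed (Primrec.tuple₂ (primrec_singleBit.comp Primrec.fst) Primrec.snd)).and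
        (CERel.wordLtFrac Primrec.snd
          (primrec_ternaryFrac.comp (primrec_singleBit.comp Primrec.fst))))
  obtain ⟨G, hGc, eG⟩ := hG.exists_listed
  obtain ⟨H, hHc, eH⟩ := hH.exists_enumerated
  refine RepFun.leSW_of_maps hGc hHc ?_
  rintro p _ rfl
  refine ⟨MeasClass.mk _ ⟨enumerated p, .of_discrete⟩,
    ⟨⟨enumerated p, .of_discrete⟩, rfl, by rw [eG, plusWords_enumerated]⟩, ?_⟩
  rintro r ⟨B, hB, hr⟩
  rw [← minusWords_congr (MeasClass.ae_eq hB)] at hr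
  refine (eH r).trans (Set.ext fun i => ?_)
  rw [Set.mem_ofPred_eq, hr]
  change _ ↔ i ∉ enumerated p
  constructor
  · rintro ⟨w, hw, hlt⟩ hi
    obtain ⟨a, ha, h1⟩ := mem_minusWords_ternary.1 hw
    obtain ⟨b, hb, h2⟩ := wordLtFrac_ternaryFrac_iff.1 hlt
    obtain rfl := ha.unique hb
    rw [Set.inter_eq_left.2 (by rw [bits_singleBit]; exact Set.singleton_subset_iff.2 hi)] at h1
    exact lt_asymm h1 h2
  · intro hi
    have h0 : 0 < ternaryMeasure.real (bits (singleBit i : Word k)) := by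
      rw [bits_singleBit, ternaryMeasure_real_singleton]; positivity
    obtain ⟨b, hb0, hb⟩ := exists_rat_btwn h0
    obtain ⟨w, hw⟩ := NuRat.surj (k := k) b
    refine ⟨w, mem_minusWords_ternary.2 ⟨b, hw, ?_⟩, wordLtFrac_ternaryFrac_iff.2 ⟨b, hw, hb⟩⟩
    have : bits (singleBit i : Word k) ∩ enumerated p = ∅ := by
      rw [bits_singleBit]; exact Set.singleton_inter_eq_empty.2 hi
    rw [this, measureReal_empty]
    exact hb0

/-- Here the complement of `K` is passed on, because an enumeration of `K` yields upper bounds for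
it. A positive lower bound for `μ({i} ∩ Kᶜ)` certifies `i ∉ K`. -/
theorem CE_leSW_minus_plus :
    (CE k).LeSW (translation
      (zetaMinus (finiteSigmaAlgebra k) ternaryMeasure isComputableMeasure_ternaryMeasure)
      (zetaPlus (finiteSigmaAlgebra k) ternaryMeasure isComputableMeasure_ternaryMeasure)) := by
  have hG : CERel fun (x : Word k) (p _ : OmegaSeq k) => ∃ t : Word k × Word k × Word k,
      x = tuple [t.1, t.2.1] ∧ bits t.2.2 ⊆ enumerated p ∧
        FracLtWord (ternaryFrac (mergeBits (fun a b => a && !b) t.1 t.2.2)) t.2.1 :=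
    CERel.exists (Q := fun (q : Word k × Word k × Word k × Word k) (p _ : OmegaSeq k) =>
      q.1 = tuple [q.2.1, q.2.2.1] ∧ bits q.2.2.2 ⊆ enumerated p ∧
        FracLtWord (ternaryFrac (mergeBits (fun a b => a && !b) q.2.1 q.2.2.2)) q.2.2.1)
      ((CERel.of_primrecPred (Primrec.eq.comp Primrec.fst
        (Primrec.tuple₂ primrec_snd_fst primrec_snd_snd_fst))).and
        ((CERel.bits_subset_enumerated primrec_snd_snd_snd).and
          (CERel.fracLtWord primrec_snd_snd_fst (primrec_ternaryFrac.comp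
            ((primrec_mergeBits _).comp primrec_snd_fst primrec_snd_snd_snd)))))
  -- The fraction of the empty word is `0 / 1`, so the second condition says that `u` denotes a
  -- positive rational.
  have hH : CERel fun (i : ℕ) (r _ : OmegaSeq k) => ∃ u : Word k,
      tuple [u, singleBit i] ∈ listed r ∧ FracLtWord (ternaryFrac ([] : Word k)) u :=
    CERel.exists (Q := fun (q : ℕ × Word k) (r _ : OmegaSeq k) =>
      tuple [q.2, singleBit q.1] ∈ listed r ∧ FracLtWord (ternaryFrac ([] : Word k)) q.2)
      ((CERel.mem_listed (Primrec.tuple₂ Primrec.snd (primrec_singleBit.comp Primrec.fst))).and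
        (CERel.fracLtWord Primrec.snd (Primrec.const _)))
  obtain ⟨G, hGc, eG⟩ := hG.exists_listed
  obtain ⟨H, hHc, eH⟩ := hH.exists_enumerated
  refine RepFun.leSW_of_maps hGc hHc ?_
  rintro p _ rfl
  refine ⟨MeasClass.mk _ ⟨(enumerated p)ᶜ, .of_discrete⟩,
    ⟨⟨(enumerated p)ᶜ, .of_discrete⟩, rfl, by rw [eG, minusWords_compl_enumerated]⟩, ?_⟩
  rintro r ⟨B, hB, hr⟩
  rw [← plusWords_congr (MeasClass.ae_eq hB)] at hr
  refine (eH r).trans (Set.ext fun i => ?_)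
  have hnil : bits ([] : Word k) = ∅ := by simp [bits]
  rw [Set.mem_ofPred_eq, hr]
  change _ ↔ i ∉ enumerated p
  constructor
  · rintro ⟨u, hu, hlt⟩ hi
    obtain ⟨a, ha, h1⟩ := mem_plusWords_ternary.1 hu
    obtain ⟨b, hb, h2⟩ := fracLtWord_ternaryFrac_iff.1 hlt
    obtain rfl := ha.unique hb
    have : bits (singleBit i : Word k) ∩ (enumerated p)ᶜ = ∅ := by
      rw [bits_singleBit]; exact Set.singleton_inter_eq_empty.2 (not_not.2 hi)
    rw [this] at h1
    rw [hnil] at h2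
    exact lt_asymm h1 h2
  · intro hi
    have h0 : 0 < ternaryMeasure.real (bits (singleBit i : Word k)) := by
      rw [bits_singleBit, ternaryMeasure_real_singleton]; positivity
    obtain ⟨b, hb0, hb⟩ := exists_rat_btwn h0
    obtain ⟨u, hu⟩ := NuRat.surj (k := k) b
    refine ⟨u, mem_plusWords_ternary.2 ⟨b, hu, ?_⟩, fracLtWord_ternaryFrac_iff.2 ⟨b, hu, ?_⟩⟩
    · rwa [Set.inter_eq_left.2 (by rw [bits_singleBit]; exact Set.singleton_subset_iff.2 hi)]
    · rwa [hnil, measureReal_empty]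

end Completeness

/-! ### The theorem, with the equivalences obtained by transitivity. -/

theorem theorem4p9 (k : ℕ) :
    (∀ (Ω : Type*) [MeasurableSpace Ω] (C : CompSigmaAlgebra k Ω) (μ : Measure Ω)
        (hμ : IsComputableMeasure C μ),
      (translation (zetaPlus C μ hμ) (zetaMinus C μ hμ)).LeSW
          (translation (zetaPlus C μ hμ) (zetaZero C μ hμ)) ∧
        (translation (zetaPlus C μ hμ) (zetaZero C μ hμ)).LeSW (CE k) ∧
        (translation (zetaPlus C μ hμ) (zetaZero C μ hμ)).LeW
          (translation (zetaPlus C μ hμ) (zetaMinus C μ hμ)) ∧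
        (translation (zetaMinus C μ hμ) (zetaPlus C μ hμ)).LeSW
          (translation (zetaMinus C μ hμ) (zetaZero C μ hμ)) ∧
        (translation (zetaMinus C μ hμ) (zetaZero C μ hμ)).LeSW (CE k) ∧
        (translation (zetaMinus C μ hμ) (zetaZero C μ hμ)).LeW
          (translation (zetaMinus C μ hμ) (zetaPlus C μ hμ))) ∧
    ∃ (C : CompSigmaAlgebra k ℕ) (μ : Measure ℕ) (hμ : IsComputableMeasure C μ),
      C.ring = {R | R.Finite} ∧ IsProbabilityMeasure μ ∧
        (∀ A : Set ℕ, μ A = ∑' i : A, ENNReal.ofReal (2 / 3 * (1 / 3) ^ (i : ℕ))) ∧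
        (translation (zetaPlus C μ hμ) (zetaMinus C μ hμ)).EquivSW (CE k) ∧
        (translation (zetaPlus C μ hμ) (zetaZero C μ hμ)).EquivSW (CE k) ∧
        (translation (zetaMinus C μ hμ) (zetaPlus C μ hμ)).EquivSW (CE k) ∧
        (translation (zetaMinus C μ hμ) (zetaZero C μ hμ)).EquivSW (CE k) := by
  refine ⟨fun Ω _ C μ hμ => ⟨plus_minus_leSW_plus_zero hμ, plus_zero_leSW_CE hμ,
    plus_zero_leW_plus_minus hμ, minus_plus_leSW_minus_zero hμ, minus_zero_leSW_CE hμ,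
    minus_zero_leW_minus_plus hμ⟩, finiteSigmaAlgebra k, ternaryMeasure,
    isComputableMeasure_ternaryMeasure, finiteSigmaAlgebra_ring, inferInstance,
    ternaryMeasure_apply, ?_, ?_, ?_, ?_⟩
  · exact ⟨(plus_minus_leSW_plus_zero _).trans (plus_zero_leSW_CE _), CE_leSW_plus_minus⟩
  · exact ⟨plus_zero_leSW_CE _, CE_leSW_plus_minus.trans (plus_minus_leSW_plus_zero _)⟩
  · exact ⟨(minus_plus_leSW_minus_zero _).trans (minus_zero_leSW_CE _), CE_leSW_minus_plus⟩
  · exact ⟨minus_zero_leSW_CE _, CE_leSW_minus_plus.trans (minus_plus_leSW_minus_zero _)⟩
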